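/- **Setting.** Let $D$ be the joint distribution of $(x,y)\in\mathbb{R}^d\times\mathbb{R}$ in the model $y=\theta_*^\top x+\xi$, where $\theta_*\in\mathbb{R}^d$ has $s_*=\|\theta_*\|_0$ non-zero entries, $\xi$ is independent of $x$, has mean zero and is sub-Gaussian with parameter $\sigma^2$, and $\|x\|_\infty\le R_\infty$ almost surely. Let $\mathcal{L}(\theta)=\mathbb{E}_{(x,y)\sim D}(\theta^\top x-y)^2$. Let $1\le s<s'\le d$ be integers and $L_s,\mu_s>0$ be such that for all $\theta_1,\theta_2$ with $\|\theta_1\|_0,\|\theta_2\|_0\le s$ $$\mathcal{L}(\theta_2)+\langle\nabla\mathcal{L}(\theta_2),\theta_1-\theta_2\rangle+\tfrac{\mu_s}{2}\|\theta_1-\theta_2\|^2\le\mathcal{L}(\theta_1)\le\mathcal{L}(\theta_2)+\langle\nabla\mathcal{L}(\theta_2),\theta_1-\theta_2\rangle+\tfrac{L_s}{2}\|\theta_1-\theta_2\|^2,$$ and put $\kappa_s=L_s/\mu_s$. Let $\mathcal{H}_s(\theta')\in\mathrm{argmin}_{\|\theta\|_0\le s}\|\theta-\theta'\|$ be the hard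 thresholding operator (ties broken by any measurable rule). **Algorithm (Exploration).** Input: an initial point in $\mathbb{R}^d$, a step size $\eta>0$, batch sizes $(B_t)_{t\ge1}$, a number of rounds $T$. Let $\theta_0$ be $\mathcal{H}_s$ of the initial point. Let $d'=\lceil d/(s'-s)\rceil$ and let $J_1,\dots,J_{d'}$ be the consecutive blocks of $s'-s$ coordinates (the last one cut off at $d$). In round $t=1,\dots,T$, put $S_{t-1}=\mathrm{supp}(\theta_{t-1})$, draw fresh independent examples $(x_i^{(b)},y_i^{(b)})\sim D$ for $i\le d'$, $b\le B_t$, observe of each only $y_i^{(b)}$ and the coordinates of $x_i^{(b)}$ in $J_i\cup S_{t-1}$, set $$g_t|_{J_i}=\frac1{B_t}\sum_{b=1}^{B_t}2\Big(\sum_{k\in S_{t-1}}\theta_{t-1}|_k\,x_i^{(b)}|_k-y_i^{(b)}\Big)x_i^{(b)}|_{J_i}\quad(i\le d'),\qquad \theta_t=\mathcal{H}_s(\theta_{t-1}-\eta g_t).$$ The number of observed samples is $\sum_{t=1}^T d'B_t$. **Corollary.** There are universal constants $c_0,a,C>0$ and $c\in(0,1)$ such that the following holds in the above setting whenever $s\ge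 c_0\kappa_s^2s_*$, for $\eta=a/L_s$ and $\check\alpha=c/\kappa_s$, for every initial point and all $\delta\in(0,1)$, $\varepsilon>0$. Let $\Delta=\mathcal{L}(\theta_0)-\mathcal{L}(\theta_*)$, $\Lambda=1+\max\{0,\log(\Delta/\varepsilon)\}$ (with $\Lambda=1$ if $\Delta=0$) and $\ell=\log\big(\frac{\kappa_s d}{\delta}\Lambda\big)$. There are $T$ and batch sizes $B_t\ge1$ ($t\ge1$) with $$B_t\le C\,\ell\,\Big(\kappa_s^2\frac{R_\infty^4}{L_s^2}s^2\ \vee\ \frac{\sigma^2}{\Delta}\frac{R_\infty^2}{L_s}\frac{Ts}{(1-\check\alpha)^T}\Big)$$ (if $\Delta=0$, the second term is omitted) such that the number of observed samples is at most $$C\,\ell\,\Big(\Lambda\,\frac{\kappa_sR_\infty^4}{\mu_s^2}\frac{ds^2}{s'-s}+\Lambda^2\,\frac{\kappa_sR_\infty^2}{\mu_s}\frac{ds}{s'-s}\frac{\sigma^2}{\varepsilon}\Big)$$ and $P\big(\mathcal{L}(\theta_T)-\mathcal{L}(\theta_*)\le\varepsilon\big)\ge1-\delta$. -/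

import Mathlib

open MeasureTheory ProbabilityTheory
open scoped NNReal

noncomputable section

namespace SparseRegression

/-- Vectors of `ℝ^d` with the Euclidean norm. -/
abbrev Vec (d : ℕ) : Type := EuclideanSpace ℝ (Fin d)

/-- The support of a vector. -/
def supp {d : ℕ} (θ : Vec d) : Finset (Fin d) := Finset.univ.filter fun j => θ j ≠ 0

/-- `‖θ‖₀`, the number of non-zero coordinates. -/
def l0 {d : ℕ} (θ : Vec d) : ℕ := (supp θ).card

/-- The population risk `𝓛(θ) = E_{(x,y) ∼ D} (θᵀx - y)²`. -/
def risk {d : ℕ} (D : Measure (Vec d × ℝ)) (θ : Vec d) : ℝ :=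
  ∫ z, (inner ℝ θ z.1 - z.2) ^ 2 ∂D

/-- The residual `ξ = y - θ_*ᵀx`. -/
def residual {d : ℕ} (θstar : Vec d) (z : Vec d × ℝ) : ℝ := z.2 - inner ℝ θstar z.1

/-- `D` is the joint law of `(x, y)` in the model `y = θ_*ᵀx + ξ`, where `ξ` is independent of `x`,
has mean zero and is sub-Gaussian with parameter `σ²`. -/
structure IsLinearModel {d : ℕ} (D : Measure (Vec d × ℝ)) (θstar : Vec d) (σ : ℝ≥0) : Prop where
  prob : IsProbabilityMeasure D
  indep : IndepFun Prod.fst (residual θstar) D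
  mean_zero : ∫ z, residual θstar z ∂D = 0
  subGaussian : HasSubgaussianMGF (residual θstar) (σ ^ 2) D

/-- `‖x‖_∞ ≤ R` almost surely. -/
def BoundedData {d : ℕ} (D : Measure (Vec d × ℝ)) (R : ℝ) : Prop :=
  ∀ᵐ z ∂D, ∀ j, |z.1 j| ≤ R

/-- Restricted smoothness of `f` at sparsity level `s` with constant `L`. -/
def RestrictedSmooth {d : ℕ} (f : Vec d → ℝ) (s : ℕ) (L : ℝ) : Prop :=
  ∀ θ₁ θ₂ : Vec d, l0 θ₁ ≤ s → l0 θ₂ ≤ s →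
    f θ₁ ≤ f θ₂ + inner ℝ (gradient f θ₂) (θ₁ - θ₂) + L / 2 * ‖θ₁ - θ₂‖ ^ 2

/-- Restricted strong convexity of `f` at sparsity level `s` with constant `μ`. -/
def RestrictedStronglyConvex {d : ℕ} (f : Vec d → ℝ) (s : ℕ) (μ : ℝ) : Prop :=
  ∀ θ₁ θ₂ : Vec d, l0 θ₁ ≤ s → l0 θ₂ ≤ s →
    f θ₂ + inner ℝ (gradient f θ₂) (θ₁ - θ₂) + μ / 2 * ‖θ₁ - θ₂‖ ^ 2 ≤ f θ₁

/-- `H` is a hard thresholding operator `𝓗_s`: `H θ'` is a point of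
`argmin_{‖θ‖₀ ≤ s} ‖θ - θ'‖`. Minimizers need not be unique, so `H` stands for an arbitrary
(measurable) rule for breaking ties. -/
structure IsHardThresholding {d : ℕ} (s : ℕ) (H : Vec d → Vec d) : Prop where
  measurable : Measurable H
  sparse : ∀ θ', l0 (H θ') ≤ s
  minimal : ∀ θ' θ, l0 θ ≤ s → ‖H θ' - θ'‖ ≤ ‖θ - θ'‖

/-- The number of blocks `d' = ⌈d / (s' - s)⌉`. -/
def numBlocks (d s' s : ℕ) : ℕ := ⌈(d : ℝ) / ((s' : ℝ) - (s : ℝ))⌉₊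

/-- The `i`-th block (`i = 0, …, d' - 1`) of `s' - s` consecutive coordinates, cut off at `d`. -/
def block (d s' s i : ℕ) : Finset (Fin d) :=
  Finset.univ.filter fun j => (s' - s) * i ≤ (j : ℕ) ∧ (j : ℕ) < (s' - s) * (i + 1)

/-- What is seen of `x` when only the coordinates in `S` are observed (the rest is blanked). -/
def observe {d : ℕ} (S : Finset (Fin d)) (x : Vec d) : Vec d :=
  WithLp.toLp 2 fun j => if j ∈ S then x j else 0

/-- The gradient estimator at `θ` from `B` examples per block; `Z i b` is the `b`-th example for
block `i`, of which only the coordinates in the block and in the support of `θ` (and the label) are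
observed. Coordinate `j` lies in block `j / (s' - s)`, and uses
`ℓ'_y(θᵀx) x_j = 2 (θᵀx - y) x_j`. -/
def gradEstimator {d : ℕ} (s' s B : ℕ) (Z : ℕ → ℕ → Vec d × ℝ) (θ : Vec d) : Vec d :=
  WithLp.toLp 2 fun j =>
    let i : ℕ := (j : ℕ) / (s' - s)
    (1 / (B : ℝ)) * ∑ b ∈ Finset.range B,
      let o : Vec d := observe (block d s' s i ∪ supp θ) (Z i b).1
      2 * ((∑ k ∈ supp θ, θ k * o k) - (Z i b).2) * o j

/-- The iterates of the Exploration algorithm: the starting point is `𝓗_s(θ₀)`, and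
`θ_t = 𝓗_s(θ_{t-1} - η g_t)`, where `g_t` is computed from the fresh examples `Z (t, i, b)`,
`i < d'`, `b < B t`. -/
def exploration {d : ℕ} (H : Vec d → Vec d) (η : ℝ) (s' s : ℕ) (B : ℕ → ℕ)
    (Z : ℕ × ℕ × ℕ → Vec d × ℝ) (θ₀ : Vec d) : ℕ → Vec d
  | 0 => H θ₀
  | t + 1 =>
    let θ := exploration H η s' s B Z θ₀ t
    H (θ - η • gradEstimator s' s (B (t + 1)) (fun i b => Z (t + 1, i, b)) θ)

/-- The number of examples drawn in the rounds `1, …, T`. -/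
def sampleCount (d s' s : ℕ) (B : ℕ → ℕ) (T : ℕ) : ℕ :=
  ∑ t ∈ Finset.Icc 1 T, numBlocks d s' s * B t

/-- `1 + log⁺ (Δ / ε)`. -/
def accuracyLog (Δ ε : ℝ) : ℝ := 1 + max 0 (Real.log (Δ / ε))

/-- `log ((κ d / δ) (1 + log⁺ (Δ / ε)))`. -/
def confidenceLog (κ : ℝ) (d : ℕ) (δ Δ ε : ℝ) : ℝ :=
  Real.log (κ * d / δ * accuracyLog Δ ε)

end SparseRegression

end

/-! ### Hard thresholding and the deterministic inexact gradient step -/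

namespace SparseRegression

/-! The method is hard-thresholded gradient descent on a quadratic risk with noisy gradients, and
the proof separates optimization from statistics.

Optimization (`risk_step_le`): thresholding a gradient step is at least as good as keeping any `s`
coordinates. Compare with the union of the supports of `θ` and `θstar`, minus its smallest entries
off the support of `θstar`. What is dropped is a fraction `‖θ_*‖₀ / s` of the mass there, so when
this ratio is of order at most `1/κ²`, restricted gradient domination still contracts the gap by a
factor `1 - 1/(16κ)`. The gradient error enters only on at most `2s` coordinates, as `s * E / L` for
a squared coordinate error `E`.

Statistics (`hasSubgaussianMGF_gradDev`, `gradProxy_le`): the error of one gradient coordinate is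
sub-Gaussian, with a variance proxy made of a term proportional to `‖θ - θstar‖²`, hence to the gap,
and a term from the label noise. As each round uses fresh examples, its iterate may be frozen, and a
union bound over rounds and coordinates gives `measure_accurate_ge`.

Combination (`exploration_gap_le`): the first term of the batch size makes the gap-proportional
error cost at most half of the contraction; the second keeps the noise accumulated over `T` rounds
below `(1 - 1/(32κ))^T * Δ`. Taking the smallest `T` with twice this quantity at most `ε`
(`exists_rounds`) gives the accuracy and, by minimality, the sample count. -/

/-- The `w` smallest values have at most the overall average. Deleting a maximal element does not
raise the average, so one deletes maxima until `w` elements remain. -/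
theorem _root_.Finset.exists_subset_card_eq_sum_le {ι : Type*} (f : ι → ℝ)
    (hf : ∀ i, 0 ≤ f i) (A : Finset ι) (w : ℕ) (hw : w ≤ A.card) :
    ∃ W ⊆ A, W.card = w ∧ (A.card : ℝ) * ∑ i ∈ W, f i ≤ w * ∑ i ∈ A, f i := by
  classical
  obtain ⟨k, hk⟩ := Nat.exists_eq_add_of_le hw
  clear hw
  induction k generalizing A with
  | zero => exact ⟨A, subset_rfl, by omega, by rw [hk]; simp⟩
  | succ k ih =>
    have hne : A.Nonempty := Finset.card_pos.mp (by omega)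
    obtain ⟨a, ha, hmax⟩ := A.exists_max_image f hne
    have hcard : (A.erase a).card = w + k := by rw [Finset.card_erase_of_mem ha]; omega
    obtain ⟨W, hWA, hWc, hW⟩ := ih (A.erase a) hcard
    refine ⟨W, hWA.trans (Finset.erase_subset _ _), hWc, ?_⟩
    have hsum : ∑ i ∈ A.erase a, f i + f a = ∑ i ∈ A, f i := Finset.sum_erase_add _ _ ha
    have hle : ∑ i ∈ A, f i ≤ A.card * f a := by
      simpa using Finset.sum_le_card_nsmul A f (f a) hmax
    rw [hcard] at hW
    rw [hk] at hle ⊢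
    push_cast at hW hle ⊢
    rcases Nat.eq_zero_or_pos (w + k) with h0 | hpos
    · have : W = ∅ := Finset.card_eq_zero.mp (by omega)
      subst this
      simp only [Finset.sum_empty, mul_zero]
      exact mul_nonneg (by positivity) (Finset.sum_nonneg fun i _ => hf i)
    · have hn : (0 : ℝ) < w + k := by exact_mod_cast hpos
      have hA : (w + k + 1 : ℝ) * ∑ i ∈ A.erase a, f i ≤ (w + k) * ∑ i ∈ A, f i := by
        nlinarith
      have hw0 : (0 : ℝ) ≤ w := by positivity
      refine le_of_mul_le_mul_left ?_ hn
      calc (w + k : ℝ) * ((w + (k + 1)) * ∑ i ∈ W, f i)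
          = (w + k + 1) * ((w + k) * ∑ i ∈ W, f i) := by ring
        _ ≤ (w + k + 1) * (w * ∑ i ∈ A.erase a, f i) := by gcongr
        _ = w * ((w + k + 1) * ∑ i ∈ A.erase a, f i) := by ring
        _ ≤ w * ((w + k) * ∑ i ∈ A, f i) := by gcongr
        _ = (w + k) * (w * ∑ i ∈ A, f i) := by ring

variable {d : ℕ}

theorem mem_supp {θ : Vec d} {j : Fin d} : j ∈ supp θ ↔ θ j ≠ 0 := by simp [supp]

theorem norm_sq_eq_sum (z : Vec d) : ‖z‖ ^ 2 = ∑ j, z j ^ 2 := by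
  simp [EuclideanSpace.norm_sq_eq]

theorem inner_eq_sum (x y : Vec d) : inner ℝ x y = ∑ j, x j * y j := by
  simp [PiLp.inner_apply, mul_comm]

theorem l0_observe_le (U : Finset (Fin d)) (z : Vec d) : l0 (observe U z) ≤ U.card := by
  refine Finset.card_le_card fun j hj => ?_
  by_contra h
  exact mem_supp.mp hj (by simp [observe, h])

/-- Minimality is tested against the restriction of `z` to `U`. This is all that is used of the
thresholding rule besides sparsity and measurability, so ties are harmless. -/
theorem IsHardThresholding.norm_sub_sq_le {s : ℕ} {H : Vec d → Vec d}
    (hH : IsHardThresholding s H) (z : Vec d) (U : Finset (Fin d)) (hU : U.card ≤ s) :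
    ‖H z - z‖ ^ 2 + ∑ j ∈ U, z j ^ 2 ≤ ‖z‖ ^ 2 := by
  have h := hH.minimal z (observe U z) ((l0_observe_le U z).trans hU)
  have h2 : ‖H z - z‖ ^ 2 ≤ ‖observe U z - z‖ ^ 2 := by gcongr
  have h3 : ‖observe U z - z‖ ^ 2 = ∑ j ∈ Uᶜ, z j ^ 2 := by
    rw [norm_sq_eq_sum, ← Finset.sum_add_sum_compl U]
    rw [Finset.sum_eq_zero, zero_add]
    · refine Finset.sum_congr rfl fun j hj => ?_
      simp [observe, Finset.mem_compl.mp hj]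
    · intro j hj
      simp [observe, hj]
  rw [norm_sq_eq_sum z, ← Finset.sum_add_sum_compl U]
  linarith

/-- Hard thresholding a gradient step decreases the quadratic model. The kept coordinates are
compared with the union of the two supports, less the smallest coordinates outside the support
of the sparse comparator. -/
theorem IsHardThresholding.norm_step_sub_sq_le {s : ℕ} {H : Vec d → Vec d}
    (hH : IsHardThresholding s H) (hs : 1 ≤ s) (θ θstar g : Vec d) (η : ℝ) (hθ : l0 θ ≤ s)
    (hle : l0 θstar ≤ s) :
    ‖H (θ - η • g) - (θ - η • g)‖ ^ 2 ≤ η ^ 2 * ‖g‖ ^ 2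
      + 2 * ((l0 θstar : ℝ) / s) * ‖θ - θstar‖ ^ 2
      - (1 - 2 * ((l0 θstar : ℝ) / s)) * η ^ 2 * ∑ j ∈ supp θ ∪ supp θstar, g j ^ 2 := by
  classical
  set z := θ - η • g with hz
  set V := supp θ ∪ supp θstar with hV
  set A := V \ supp θstar with hA
  set r : ℝ := (l0 θstar : ℝ) / s with hr
  have hs0 : (0 : ℝ) < s := by exact_mod_cast hs
  have hr0 : 0 ≤ r := by positivity
  have hAc : A.card + l0 θstar = V.card := by
    rw [hA]; exact Finset.card_sdiff_add_card_eq_card Finset.subset_union_right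
  have hVc : V.card ≤ l0 θ + l0 θstar := Finset.card_union_le _ _
  obtain ⟨W, hWA, hWc, hW⟩ := Finset.exists_subset_card_eq_sum_le (fun j => z j ^ 2)
    (fun j => sq_nonneg _) A (V.card - s) (by omega)
  have hWV : W ⊆ V := hWA.trans Finset.sdiff_subset
  have hAnn : 0 ≤ ∑ j ∈ A, z j ^ 2 := Finset.sum_nonneg fun j _ => sq_nonneg _
  -- With `w` dropped coordinates and `k = l0 θstar`, the fraction is `w / (w + s - k)`. It
  -- increases in `w`, and `w ≤ k`, so it is at most `k / s`.
  have hratio : ∑ j ∈ W, z j ^ 2 ≤ r * ∑ j ∈ A, z j ^ 2 := by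
    rcases le_or_gt V.card s with h | h
    · have : W = ∅ := Finset.card_eq_zero.mp (by omega)
      subst this
      simpa using mul_nonneg hr0 hAnn
    · obtain ⟨w, hw⟩ := Nat.exists_eq_add_of_lt h
      have e1 : V.card - s = w + 1 := by omega
      rw [e1] at hW
      have hcA : (A.card : ℝ) = (w + 1 : ℕ) + s - l0 θstar := by
        have : A.card + l0 θstar = (w + 1) + s := by omega
        have : (A.card : ℝ) + l0 θstar = (w + 1 : ℕ) + s := by exact_mod_cast this
        linarith
      have hws : ((w + 1 : ℕ) : ℝ) ≤ l0 θstar := by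
        have : w + 1 ≤ l0 θstar := by omega
        exact_mod_cast this
      have hls : (l0 θstar : ℝ) ≤ s := by exact_mod_cast hle
      have hApos : (0 : ℝ) < A.card := by
        rw [hcA]
        have : (0 : ℝ) < (w + 1 : ℕ) := by positivity
        linarith
      refine le_of_mul_le_mul_left (hW.trans ?_) hApos
      rw [← mul_assoc]
      refine mul_le_mul_of_nonneg_right ?_ hAnn
      rw [hr, mul_div_assoc', le_div_iff₀ hs0, hcA]
      nlinarith
  -- Off the support of `θstar`, the entry `θ j` is already an entry of `θ - θstar`.
  have hAle : ∑ j ∈ A, z j ^ 2 ≤ 2 * ‖θ - θstar‖ ^ 2 + 2 * (η ^ 2 * ∑ j ∈ V, g j ^ 2) := by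
    have h1 : ∑ j ∈ A, z j ^ 2 ≤
        ∑ j ∈ A, (2 * (θ - θstar) j ^ 2 + 2 * (η ^ 2 * g j ^ 2)) := by
      refine Finset.sum_le_sum fun j hj => ?_
      have hj0 : θstar j = 0 := by
        by_contra h
        exact (Finset.mem_sdiff.mp hj).2 (mem_supp.mpr h)
      simp only [hz, PiLp.sub_apply, PiLp.smul_apply, smul_eq_mul, hj0, sub_zero]
      nlinarith [sq_nonneg (θ j + η * g j)]
    rw [Finset.sum_add_distrib, ← Finset.mul_sum, ← Finset.mul_sum, ← Finset.mul_sum] at h1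
    have h2 : ∑ j ∈ A, (θ - θstar) j ^ 2 ≤ ‖θ - θstar‖ ^ 2 := by
      rw [norm_sq_eq_sum]
      exact Finset.sum_le_sum_of_subset_of_nonneg (Finset.subset_univ _)
        fun j _ _ => sq_nonneg _
    have h3 : ∑ j ∈ A, g j ^ 2 ≤ ∑ j ∈ V, g j ^ 2 :=
      Finset.sum_le_sum_of_subset_of_nonneg Finset.sdiff_subset fun j _ _ => sq_nonneg _
    have h4 : η ^ 2 * ∑ j ∈ A, g j ^ 2 ≤ η ^ 2 * ∑ j ∈ V, g j ^ 2 := by gcongr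
    linarith
  have hmain := hH.norm_sub_sq_le z (V \ W) (by
    rw [Finset.card_sdiff_of_subset hWV]; omega)
  have hsplit : ∑ j ∈ V \ W, z j ^ 2 + ∑ j ∈ W, z j ^ 2 = ∑ j ∈ V, z j ^ 2 :=
    Finset.sum_sdiff hWV
  have hzz : ‖z‖ ^ 2 = ∑ j ∈ V, z j ^ 2 + η ^ 2 * (‖g‖ ^ 2 - ∑ j ∈ V, g j ^ 2) := by
    rw [norm_sq_eq_sum z, norm_sq_eq_sum g, ← Finset.sum_add_sum_compl V fun j => g j ^ 2,
      add_sub_cancel_left, ← Finset.sum_add_sum_compl V, Finset.mul_sum]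
    congr 1
    refine Finset.sum_congr rfl fun j hj => ?_
    have hj0 : θ j = 0 := by
      by_contra h
      exact (Finset.mem_compl.mp hj) (Finset.mem_union_left _ (mem_supp.mpr h))
    simp only [hz, PiLp.sub_apply, PiLp.smul_apply, smul_eq_mul, hj0]
    ring
  have hfin := mul_le_mul_of_nonneg_left hAle hr0
  nlinarith

/-- Young's inequality coordinatewise. Only the part of `e` on `U` is charged, which keeps gradient
errors from accumulating over all `d` coordinates. -/
theorem neg_inner_le {L : ℝ} (hL : 0 < L) (e v : Vec d) (U : Finset (Fin d))
    (h0 : ∀ j ∉ U, v j = 0) :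
    -inner ℝ e v ≤ 1 / (2 * L) * ∑ j ∈ U, e j ^ 2 + L / 2 * ‖v‖ ^ 2 := by
  have h1 : inner ℝ e v = ∑ j ∈ U, e j * v j := by
    rw [inner_eq_sum]
    symm
    refine Finset.sum_subset (Finset.subset_univ _) fun j _ hj => ?_
    rw [h0 j hj, mul_zero]
  have h2 : ‖v‖ ^ 2 = ∑ j ∈ U, v j ^ 2 := by
    rw [norm_sq_eq_sum]
    symm
    refine Finset.sum_subset (Finset.subset_univ _) fun j _ hj => ?_
    rw [h0 j hj]; norm_num
  rw [h1, h2, Finset.mul_sum, Finset.mul_sum, ← Finset.sum_neg_distrib, ← Finset.sum_add_distrib]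
  refine Finset.sum_le_sum fun j _ => ?_
  have : 0 ≤ 1 / (2 * L) * (e j + L * v j) ^ 2 := by positivity
  have h3 : 1 / (2 * L) * (e j + L * v j) ^ 2 =
    1 / (2 * L) * e j ^ 2 + e j * v j + L / 2 * v j ^ 2 := by
    field_simp; ring
  linarith

theorem sub_eq_zero_of_notMem_supp {θ₁ θ₂ : Vec d} {j : Fin d} (hj : j ∉ supp θ₂ ∪ supp θ₁) :
    (θ₁ - θ₂) j = 0 := by
  simp only [Finset.mem_union, mem_supp, not_or, not_not] at hj
  simp [hj.1, hj.2]

/-- Restricted gradient domination. -/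
theorem RestrictedStronglyConvex.gap_le {f : Vec d → ℝ} {s : ℕ} {μ : ℝ}
    (hsc : RestrictedStronglyConvex f s μ) (hμ : 0 < μ) {θ θstar : Vec d} (hθ : l0 θ ≤ s)
    (hle : l0 θstar ≤ s) :
    2 * μ * (f θ - f θstar) ≤ ∑ j ∈ supp θ ∪ supp θstar, gradient f θ j ^ 2 := by
  have h1 := hsc θstar θ hle hθ
  have h2 := neg_inner_le hμ (gradient f θ) (θstar - θ) (supp θ ∪ supp θstar)
    fun j hj => sub_eq_zero_of_notMem_supp hj
  have h3 : f θ - f θstar ≤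
      1 / (2 * μ) * ∑ j ∈ supp θ ∪ supp θstar, gradient f θ j ^ 2 := by linarith
  calc _ ≤ 2 * μ * (1 / (2 * μ) * ∑ j ∈ supp θ ∪ supp θstar, gradient f θ j ^ 2) := by gcongr
    _ = _ := by field_simp

/-- The quadratic term has coefficient `L`, twice what smoothness needs; the spare `L / 2` later
absorbs the cross term with the gradient error. -/
theorem IsHardThresholding.model_step_le {s : ℕ} {H : Vec d → Vec d}
    (hH : IsHardThresholding s H) (hs : 1 ≤ s) (θ θstar g : Vec d) {L : ℝ} (hL : 0 < L)
    (hθ : l0 θ ≤ s) (hle : l0 θstar ≤ s) (hr : 4 * ((l0 θstar : ℝ) / s) ≤ 1) :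
    inner ℝ g (H (θ - (1 / 2 / L) • g) - θ) + L * ‖H (θ - (1 / 2 / L) • g) - θ‖ ^ 2 ≤
      2 * (L * ((l0 θstar : ℝ) / s)) * ‖θ - θstar‖ ^ 2
        - 1 / 8 / L * ∑ j ∈ supp θ ∪ supp θstar, g j ^ 2 := by
  classical
  have hstep := hH.norm_step_sub_sq_le hs θ θstar g (1 / 2 / L) hθ hle
  have hV0 : 0 ≤ ∑ j ∈ supp θ ∪ supp θstar, g j ^ 2 := Finset.sum_nonneg fun j _ => sq_nonneg _
  generalize H (θ - (1 / 2 / L) • g) = θ' at hstep ⊢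
  generalize (l0 θstar : ℝ) / s = r at hstep hr ⊢
  generalize ∑ j ∈ supp θ ∪ supp θstar, g j ^ 2 = G at hstep hV0 ⊢
  -- Completing the square: for step size `1 / (2L)`, multiplying by `L` turns this into the
  -- quadratic model plus a multiple of `‖g‖ ^ 2`, which cancels.
  have hexp : ‖θ' - (θ - (1 / 2 / L) • g)‖ ^ 2 =
      ‖θ' - θ‖ ^ 2 + 2 * (1 / 2 / L) * inner ℝ g (θ' - θ) + (1 / 2 / L) ^ 2 * ‖g‖ ^ 2 := by
    have : θ' - (θ - (1 / 2 / L) • g) = (θ' - θ) + (1 / 2 / L) • g := by abel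
    rw [this, norm_add_sq_real, inner_smul_right, norm_smul, mul_pow, real_inner_comm,
      Real.norm_eq_abs, sq_abs]
    ring
  rw [hexp] at hstep
  generalize inner ℝ g (θ' - θ) = p at hstep ⊢
  generalize ‖θ' - θ‖ ^ 2 = q at hstep ⊢
  generalize ‖θ - θstar‖ ^ 2 = v at hstep ⊢
  have h1 : L * (q + 2 * (1 / 2 / L) * p) ≤
      L * (2 * r * v - (1 - 2 * r) * (1 / 2 / L) ^ 2 * G) :=
    mul_le_mul_of_nonneg_left (by linarith) hL.le
  have h2 : L * (q + 2 * (1 / 2 / L) * p) = L * q + p := by field_simp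
  have h3 : L * (2 * r * v - (1 - 2 * r) * (1 / 2 / L) ^ 2 * G) =
      2 * (L * r) * v - (1 - 2 * r) * 2 * (1 / 8 / L * G) := by field_simp; ring
  have h4 : 0 ≤ 1 / 8 / L * G := by positivity
  rw [h2, h3] at h1
  nlinarith

/-- Contraction of the suboptimality in one step of hard thresholded gradient descent with an
inexact gradient `g`, whose coordinates have error at most `√E`. -/
theorem risk_step_le {s : ℕ} {H : Vec d → Vec d} (hH : IsHardThresholding s H) (hs : 1 ≤ s)
    {f : Vec d → ℝ} {L μ : ℝ} (hL : 0 < L) (hμ : 0 < μ)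
    (hsm : RestrictedSmooth f s L) (hsc : RestrictedStronglyConvex f s μ) (hκ : 1 ≤ L / μ)
    {θstar : Vec d} (hgrad : gradient f θstar = 0)
    (hstar : 64 * (L / μ) ^ 2 * (l0 θstar : ℝ) ≤ s)
    {θ g : Vec d} (hθ : l0 θ ≤ s) {E : ℝ} (hE0 : 0 ≤ E)
    (hE : ∀ j, (g j - gradient f θ j) ^ 2 ≤ E) :
    f (H (θ - (1 / 2 / L) • g)) - f θstar ≤
      (1 - 1 / (16 * (L / μ))) * (f θ - f θstar) + 5 / 4 * (s * E) / L := by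
  classical
  set κ := L / μ with hκdef
  have hLκ : L = κ * μ := by rw [hκdef]; field_simp
  have hκ0 : 0 < κ := by linarith
  have hs0 : (0 : ℝ) < s := by exact_mod_cast hs
  have hl0 : (0 : ℝ) ≤ l0 θstar := by positivity
  have hle : l0 θstar ≤ s := by
    have : (l0 θstar : ℝ) ≤ s := by
      nlinarith [mul_le_mul_of_nonneg_right (one_le_pow₀ hκ : 1 ≤ κ ^ 2) hl0]
    exact_mod_cast this
  set r : ℝ := (l0 θstar : ℝ) / s with hr
  have hr0 : 0 ≤ r := by positivity
  have hrκ : 64 * κ ^ 2 * r ≤ 1 := by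
    rw [hr, mul_div_assoc', div_le_one hs0]; exact hstar
  have hr4 : 4 * r ≤ 1 := by nlinarith
  set θ' := H (θ - (1 / 2 / L) • g) with hθ'
  set V := supp θ ∪ supp θstar with hV
  set e : Vec d := g - gradient f θ with he
  have hmodel := hH.model_step_le hs θ θstar g hL hθ hle hr4
  rw [← hθ', ← hr, ← hV] at hmodel
  have hsmooth := hsm θ' θ (hH.sparse _) hθ
  have hinner : inner ℝ (gradient f θ) (θ' - θ) = inner ℝ g (θ' - θ) - inner ℝ e (θ' - θ) := by
    rw [he, inner_sub_left]; ring
  have herrI : -inner ℝ e (θ' - θ) ≤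
      1 / (2 * L) * ∑ j ∈ supp θ' ∪ supp θ, e j ^ 2 + L / 2 * ‖θ' - θ‖ ^ 2 :=
    neg_inner_le hL _ _ _ fun j hj =>
      sub_eq_zero_of_notMem_supp (by rwa [Finset.union_comm])
  have hcard : ∀ θ₁ θ₂ : Vec d, l0 θ₁ ≤ s → l0 θ₂ ≤ s →
      ∑ j ∈ supp θ₁ ∪ supp θ₂, e j ^ 2 ≤ 2 * s * E := by
    intro θ₁ θ₂ h₁ h₂
    have h1 := Finset.sum_le_card_nsmul (supp θ₁ ∪ supp θ₂) (fun j => e j ^ 2) E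
      fun j _ => hE j
    have h2 : (supp θ₁ ∪ supp θ₂).card ≤ 2 * s :=
      (Finset.card_union_le _ _).trans (by unfold l0 at h₁ h₂; omega)
    rw [nsmul_eq_mul] at h1
    refine h1.trans (mul_le_mul_of_nonneg_right ?_ hE0)
    exact_mod_cast h2
  have hI := hcard θ' θ (hH.sparse _) hθ
  have hVe := hcard θ θstar hθ hle
  rw [← hV] at hVe
  have hgV : 1 / 2 * ∑ j ∈ V, gradient f θ j ^ 2 - ∑ j ∈ V, e j ^ 2 ≤ ∑ j ∈ V, g j ^ 2 := by
    rw [Finset.mul_sum, ← Finset.sum_sub_distrib]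
    refine Finset.sum_le_sum fun j _ => ?_
    have : gradient f θ j = g j - e j := by simp [he]
    rw [this]
    nlinarith [sq_nonneg (g j + e j)]
  have hdist : μ / 2 * ‖θ - θstar‖ ^ 2 ≤ f θ - f θstar := by
    have := hsc θ θstar hθ hle
    rw [hgrad, inner_zero_left] at this
    linarith
  have hPL := hsc.gap_le hμ hθ hle
  rw [← hV] at hPL
  have hgap0 : 0 ≤ f θ - f θstar := le_trans (by positivity) hdist
  -- The thresholding loss. The constant 64 makes it half of the decrease `1 / (8κ)` times the gap
  -- that gradient domination provides in `he1`.
  have hb : 2 * (L * r) * ‖θ - θstar‖ ^ 2 ≤ 1 / (16 * κ) * (f θ - f θstar) := by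
    have h1 : L * r ≤ μ / (64 * κ) := by
      rw [le_div_iff₀ (by positivity), hLκ]
      nlinarith
    calc 2 * (L * r) * ‖θ - θstar‖ ^ 2
      _ ≤ 2 * (μ / (64 * κ)) * ‖θ - θstar‖ ^ 2 := by gcongr
      _ = 1 / (16 * κ) * (μ / 2 * ‖θ - θstar‖ ^ 2) := by field_simp; ring
      _ ≤ _ := by gcongr
  have hc : (1 / 8) / L * (1 / 2 * (2 * μ * (f θ - f θstar))) - (1 / 8) / L * (2 * s * E) ≤
      (1 / 8) / L * ∑ j ∈ V, g j ^ 2 := by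
    rw [← mul_sub]
    have : (0 : ℝ) ≤ 1 / 8 / L := by positivity
    exact mul_le_mul_of_nonneg_left (by linarith) this
  have hd : 1 / (2 * L) * ∑ j ∈ supp θ' ∪ supp θ, e j ^ 2 ≤ 1 / (2 * L) * (2 * s * E) := by
    gcongr
  have hkey : f θ' - f θ ≤ 1 / (16 * κ) * (f θ - f θstar)
      - ((1 / 8) / L * (1 / 2 * (2 * μ * (f θ - f θstar))) - (1 / 8) / L * (2 * s * E))
      + 1 / (2 * L) * (2 * s * E) := by
    linarith
  have he1 : (1 / 8) / L * (1 / 2 * (2 * μ * (f θ - f θstar))) =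
      2 * (1 / (16 * κ) * (f θ - f θstar)) := by
    rw [hLκ]; field_simp; ring
  have he2 : (1 / 8) / L * (2 * s * E) + 1 / (2 * L) * (2 * s * E) = 5 / 4 * (s * E) / L := by
    field_simp; ring
  linarith

end SparseRegression

/-! ### The population risk and its gradient -/

namespace SparseRegression

variable {d : ℕ} {D : Measure (Vec d × ℝ)} {θstar : Vec d} {σ : ℝ≥0} {R : ℝ}

theorem measurable_residual (θstar : Vec d) : Measurable (residual θstar) := by
  unfold residual; fun_prop

theorem inner_sub_label (θ θstar : Vec d) (z : Vec d × ℝ) :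
    inner ℝ θ z.1 - z.2 = inner ℝ (θ - θstar) z.1 - residual θstar z := by
  simp only [residual, inner_sub_left]; ring

theorem BoundedData.abs_inner_le (hb : BoundedData D R) (h : Vec d) :
    ∀ᵐ z ∂D, |inner ℝ h z.1| ≤ R * ∑ j, |h j| := by
  filter_upwards [hb] with z hz
  rw [inner_eq_sum, Finset.mul_sum]
  refine (Finset.abs_sum_le_sum_abs _ _).trans (Finset.sum_le_sum fun j _ => ?_)
  rw [abs_mul, mul_comm]
  exact mul_le_mul_of_nonneg_right (hz j) (abs_nonneg _)

theorem BoundedData.memLp_inner [IsFiniteMeasure D] (hb : BoundedData D R) (h : Vec d) :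
    MemLp (fun z : Vec d × ℝ => inner ℝ h z.1) 2 D :=
  MemLp.of_bound (by fun_prop) (R * ∑ j, |h j|) (hb.abs_inner_le h)

theorem BoundedData.memLp_coord [IsFiniteMeasure D] (hb : BoundedData D R) (j : Fin d) :
    MemLp (fun z : Vec d × ℝ => z.1 j) 2 D :=
  MemLp.of_bound (by fun_prop) R (hb.mono fun _ hz => hz j)

theorem IsLinearModel.memLp_residual (hD : IsLinearModel D θstar σ) :
    MemLp (residual θstar) 2 D := by
  simpa using hD.subGaussian.memLp 2

theorem IsLinearModel.memLp_loss (hD : IsLinearModel D θstar σ) (hb : BoundedData D R)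
    (θ : Vec d) : MemLp (fun z : Vec d × ℝ => inner ℝ θ z.1 - z.2) 2 D := by
  have := hD.prob
  simp_rw [inner_sub_label θ θstar]
  exact (hb.memLp_inner _).sub hD.memLp_residual

/-- The gradient of the population risk. -/
noncomputable def riskGrad (D : Measure (Vec d × ℝ)) (θstar θ : Vec d) : Vec d :=
  WithLp.toLp 2 fun j => ∫ z, 2 * inner ℝ (θ - θstar) z.1 * z.1 j ∂D

theorem riskGrad_self : riskGrad D θstar θstar = 0 := by
  ext j; simp [riskGrad]

/-- The estimator is unbiased: the noise part averages to zero because the residual is centred and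
independent of `x`. -/
theorem IsLinearModel.integral_loss_mul (hD : IsLinearModel D θstar σ) (hb : BoundedData D R)
    (θ : Vec d) (j : Fin d) :
    ∫ z, 2 * (inner ℝ θ z.1 - z.2) * z.1 j ∂D = riskGrad D θstar θ j := by
  have := hD.prob
  have hzero : ∫ z, z.1 j * residual θstar z ∂D = 0 := by
    have hi : IndepFun (fun z : Vec d × ℝ => z.1 j) (residual θstar) D :=
      hD.indep.comp (φ := fun x : Vec d => x j) (ψ := id) (by fun_prop) measurable_id
    have := hi.integral_mul_eq_mul_integral (by fun_prop)
      (measurable_residual θstar).aestronglyMeasurable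
    rw [hD.mean_zero, mul_zero] at this
    exact this
  have h1 : Integrable (fun z : Vec d × ℝ => 2 * inner ℝ (θ - θstar) z.1 * z.1 j) D := by
    simpa [mul_assoc] using
      ((hb.memLp_inner (θ - θstar)).integrable_mul (hb.memLp_coord j)).const_mul 2
  have h2 : Integrable (fun z : Vec d × ℝ => 2 * (z.1 j * residual θstar z)) D :=
    ((hb.memLp_coord j).integrable_mul hD.memLp_residual).const_mul 2
  have h3 : ∀ z : Vec d × ℝ, 2 * (inner ℝ θ z.1 - z.2) * z.1 j =
      2 * inner ℝ (θ - θstar) z.1 * z.1 j - 2 * (z.1 j * residual θstar z) := by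
    intro z; rw [inner_sub_label θ θstar]; ring
  simp_rw [h3]
  rw [integral_sub h1 h2, integral_const_mul, hzero, mul_zero, sub_zero, riskGrad]

theorem IsLinearModel.risk_add (hD : IsLinearModel D θstar σ) (hb : BoundedData D R)
    (θ h : Vec d) :
    risk D (θ + h) = risk D θ + inner ℝ (riskGrad D θstar θ) h + ∫ z, inner ℝ h z.1 ^ 2 ∂D := by
  have := hD.prob
  have hl := hD.memLp_loss hb θ
  have hi := hb.memLp_inner h
  have i1 : Integrable (fun z : Vec d × ℝ => (inner ℝ θ z.1 - z.2) ^ 2) D := hl.integrable_sq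
  have i3 : Integrable (fun z : Vec d × ℝ => inner ℝ h z.1 ^ 2) D := hi.integrable_sq
  have ij : ∀ j, Integrable (fun z : Vec d × ℝ =>
      2 * (inner ℝ θ z.1 - z.2) * z.1 j * h j) D := by
    intro j
    simpa [mul_assoc] using ((hl.integrable_mul (hb.memLp_coord j)).const_mul 2).mul_const (h j)
  have i2 : Integrable (fun z : Vec d × ℝ =>
      ∑ j, 2 * (inner ℝ θ z.1 - z.2) * z.1 j * h j) D :=
    integrable_finsetSum _ fun j _ => ij j
  have e : ∀ z : Vec d × ℝ, (inner ℝ (θ + h) z.1 - z.2) ^ 2 =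
      ((inner ℝ θ z.1 - z.2) ^ 2 + ∑ j, 2 * (inner ℝ θ z.1 - z.2) * z.1 j * h j)
        + inner ℝ h z.1 ^ 2 := by
    intro z
    have : ∑ j, 2 * (inner ℝ θ z.1 - z.2) * z.1 j * h j =
        2 * (inner ℝ θ z.1 - z.2) * inner ℝ h z.1 := by
      rw [inner_eq_sum h, Finset.mul_sum]
      exact Finset.sum_congr rfl fun j _ => by ring
    rw [this, inner_add_left]; ring
  unfold risk
  simp_rw [e]
  have e2 := integral_add (i1.add i2) i3
  simp only [Pi.add_apply] at e2
  rw [e2, integral_add i1 i2, integral_finsetSum _ fun j _ => ij j, inner_eq_sum]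
  simp_rw [integral_mul_const, hD.integral_loss_mul hb θ]

theorem BoundedData.integral_inner_sq_le [IsProbabilityMeasure D] (hb : BoundedData D R)
    (h : Vec d) : ∫ z, inner ℝ h z.1 ^ 2 ∂D ≤ R ^ 2 * (∑ j, |h j|) ^ 2 := by
  calc ∫ z, inner ℝ h z.1 ^ 2 ∂D ≤ ∫ _, R ^ 2 * (∑ j, |h j|) ^ 2 ∂D := by
        refine integral_mono_ae (hb.memLp_inner h).integrable_sq (integrable_const _) ?_
        filter_upwards [hb.abs_inner_le h] with z hz
        rw [← mul_pow, ← sq_abs (inner ℝ h z.1)]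
        gcongr
    _ = _ := by simp

/-- Cauchy–Schwarz on the support. It converts the ℓ¹ bound that `‖x‖_∞ ≤ R` gives on inner products
into a Euclidean one. -/
theorem sum_abs_sq_le (v : Vec d) (n : ℕ) (hn : l0 v ≤ n) :
    (∑ j, |v j|) ^ 2 ≤ n * ‖v‖ ^ 2 := by
  have h1 : ∑ j, |v j| = ∑ j ∈ supp v, |v j| := by
    symm
    refine Finset.sum_subset (Finset.subset_univ _) fun j _ hj => ?_
    simp only [mem_supp, not_not] at hj
    simp [hj]
  rw [h1]
  refine sq_sum_le_card_mul_sum_sq.trans ?_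
  refine mul_le_mul (by exact_mod_cast hn) ?_ (Finset.sum_nonneg fun j _ => sq_nonneg _)
    (by positivity)
  rw [norm_sq_eq_sum]
  simp only [sq_abs]
  exact Finset.sum_le_sum_of_subset_of_nonneg (Finset.subset_univ _) fun j _ _ => sq_nonneg _

theorem l0_sub_le (θ₁ θ₂ : Vec d) : l0 (θ₁ - θ₂) ≤ l0 θ₁ + l0 θ₂ := by
  classical
  refine (Finset.card_le_card (t := supp θ₁ ∪ supp θ₂) fun j hj => ?_).trans
    (Finset.card_union_le _ _)
  by_contra h
  exact mem_supp.mp hj (sub_eq_zero_of_notMem_supp (by rwa [Finset.union_comm] at h))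

/-- The expansion `risk_add` is exact, and its last term is quadratic in `h`, hence negligible to
first order. -/
theorem IsLinearModel.gradient_risk (hD : IsLinearModel D θstar σ) (hb : BoundedData D R)
    (θ : Vec d) : gradient (risk D) θ = riskGrad D θstar θ := by
  have := hD.prob
  refine HasGradientAt.gradient ?_
  rw [hasGradientAt_iff_isLittleO_nhds_zero]
  have h1 : ∀ h : Vec d, risk D (θ + h) - risk D θ - inner ℝ (riskGrad D θstar θ) h =
      ∫ z, inner ℝ h z.1 ^ 2 ∂D := fun h => by rw [hD.risk_add hb]; ring
  simp_rw [h1]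
  have h2 : (fun h : Vec d => ∫ z, inner ℝ h z.1 ^ 2 ∂D) =O[nhds 0] fun h => ‖h‖ ^ 2 := by
    refine Asymptotics.IsBigO.of_bound (R ^ 2 * d) (Filter.Eventually.of_forall fun h => ?_)
    have h3 : (0 : ℝ) ≤ ∫ z, inner ℝ h z.1 ^ 2 ∂D := integral_nonneg fun z => sq_nonneg _
    have h4 := sum_abs_sq_le h d (by
      simpa [l0] using (Finset.card_le_univ (supp h)))
    rw [Real.norm_of_nonneg h3, Real.norm_of_nonneg (by positivity), mul_assoc]
    exact (hb.integral_inner_sq_le h).trans (by gcongr)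
  refine h2.trans_isLittleO ?_
  exact Asymptotics.isLittleO_norm_pow_id one_lt_two

theorem l0_single_le (i : Fin d) (a : ℝ) : l0 (EuclideanSpace.single i a : Vec d) ≤ 1 := by
  refine Finset.card_le_one.mpr fun j hj k hk => ?_
  simp only [mem_supp, PiLp.single_apply, ne_eq, ite_eq_right_iff, Classical.not_imp] at hj hk
  exact hj.1.trans hk.1.symm

theorem one_le_of_strong_convexity_smoothness {f : Vec d → ℝ} {s : ℕ} {L μ : ℝ} (hs : 1 ≤ s)
    (hd : 0 < d) (hμ : 0 < μ) (hsm : RestrictedSmooth f s L)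
    (hsc : RestrictedStronglyConvex f s μ) : 1 ≤ L / μ := by
  let v : Vec d := EuclideanSpace.single ⟨0, hd⟩ 1
  have hv : l0 v ≤ s := (l0_single_le _ _).trans hs
  have h0 : l0 (0 : Vec d) ≤ s := by simp [l0, supp]
  have h1 := (hsc v 0 hv h0).trans (hsm v 0 hv h0)
  have : ‖v - 0‖ = 1 := by simp [v]
  rw [this] at h1
  rw [le_div_iff₀ hμ]
  linarith

/-- Curvature along a coordinate vector is twice a second moment of `x`. The bound keeps the first
batch-size term away from zero, so that rounding up to an integer is affordable. -/
theorem IsLinearModel.strong_convexity_le (hD : IsLinearModel D θstar σ) (hb : BoundedData D R)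
    {s : ℕ} {μ : ℝ} (hs : 1 ≤ s) (hd : 0 < d) (hsc : RestrictedStronglyConvex (risk D) s μ) :
    μ ≤ 2 * R ^ 2 := by
  have := hD.prob
  let v : Vec d := EuclideanSpace.single ⟨0, hd⟩ 1
  have hv1 : l0 v ≤ 1 := l0_single_le _ _
  have h0 : l0 (0 : Vec d) ≤ s := by simp [l0, supp]
  have h1 := hsc v 0 (hv1.trans hs) h0
  have hn : ‖v‖ = 1 := by simp [v]
  have h2 := hD.risk_add hb 0 v
  rw [zero_add] at h2
  rw [hD.gradient_risk hb, sub_zero, hn, h2] at h1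
  have h3 := hb.integral_inner_sq_le v
  have h4 := sum_abs_sq_le v 1 hv1
  rw [hn] at h4
  have h5 : R ^ 2 * (∑ j, |v j|) ^ 2 ≤ R ^ 2 * 1 := by
    gcongr; simpa using h4
  linarith

end SparseRegression

/-! ### Sub-Gaussian concentration of the gradient estimator -/

/-- A centred bounded variable plus a bounded multiple of an independent sub-Gaussian variable
is sub-Gaussian. -/
theorem ProbabilityTheory.HasSubgaussianMGF.prod_of_bounded {α : Type*} [MeasurableSpace α]
    {μ : Measure α} [IsProbabilityMeasure μ] {ν : Measure ℝ} [IsProbabilityMeasure ν]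
    {A b : α → ℝ} (hA : Measurable A) (hbm : Measurable b) {M K τ : ℝ≥0}
    (hAM : ∀ᵐ x ∂μ, |A x| ≤ M) (hbK : ∀ᵐ x ∂μ, |b x| ≤ K) (hν : HasSubgaussianMGF id τ ν) :
    HasSubgaussianMGF (fun p : α × ℝ => A p.1 - μ[A] + b p.1 * p.2) (M ^ 2 + K ^ 2 * τ)
      (μ.prod ν) := by
  have hX : HasSubgaussianMGF (fun x => A x - μ[A]) (M ^ 2) μ := by
    have := hasSubgaussianMGF_of_mem_Icc (X := A) (a := -(M : ℝ)) (b := M) hA.aemeasurable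
      (hAM.mono fun x hx => abs_le.mp hx)
    have e : (‖(M : ℝ) - -(M : ℝ)‖₊ / 2) ^ 2 = M ^ 2 := by
      congr 1
      rw [sub_neg_eq_add, ← two_mul, nnnorm_mul]
      ext
      simp
    rwa [e] at this
  set ψ : α × ℝ → ℝ := fun p => A p.1 - μ[A] + b p.1 * p.2 with hψ
  have hψm : Measurable ψ := by fun_prop
  -- The summands are dependent through `x`, so one integrates over the noise first, with `x` fixed,
  -- and then applies Hoeffding's lemma to `A`. Lower integrals allow Tonelli before integrability
  -- is known; integrability then follows from the bound.
  have hbound : ∀ t : ℝ, ∫⁻ p, ENNReal.ofReal (Real.exp (t * ψ p)) ∂(μ.prod ν) ≤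
      ENNReal.ofReal (Real.exp ((M ^ 2 + K ^ 2 * τ : ℝ≥0) * t ^ 2 / 2)) := by
    intro t
    rw [lintegral_prod _ (by fun_prop)]
    have hinner : ∀ᵐ x ∂μ, ∫⁻ u, ENNReal.ofReal (Real.exp (t * ψ (x, u))) ∂ν ≤
        ENNReal.ofReal (Real.exp (t * (A x - μ[A]))) *
          ENNReal.ofReal (Real.exp (K ^ 2 * τ * t ^ 2 / 2)) := by
      filter_upwards [hbK] with x hx
      have h1 : ∀ u, ENNReal.ofReal (Real.exp (t * ψ (x, u))) =
          ENNReal.ofReal (Real.exp (t * (A x - μ[A]))) *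
            ENNReal.ofReal (Real.exp (t * b x * id u)) := by
        intro u
        rw [← ENNReal.ofReal_mul (Real.exp_nonneg _), ← Real.exp_add]
        simp only [hψ, id]
        ring_nf
      simp_rw [h1]
      rw [lintegral_const_mul _ (by fun_prop)]
      gcongr
      rw [← ofReal_integral_eq_lintegral_ofReal (hν.integrable_exp_mul _)
        (Filter.Eventually.of_forall fun u => Real.exp_nonneg _)]
      refine ENNReal.ofReal_le_ofReal ((hν.mgf_le (t * b x)).trans ?_)
      rw [Real.exp_le_exp]
      have : b x ^ 2 ≤ (K : ℝ) ^ 2 := by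
        rw [← sq_abs (b x)]; gcongr
      have h2 : (0 : ℝ) ≤ τ * t ^ 2 / 2 := by positivity
      nlinarith
    refine (lintegral_mono_ae hinner).trans ?_
    rw [lintegral_mul_const _ (by fun_prop),
      ← ofReal_integral_eq_lintegral_ofReal (hX.integrable_exp_mul _)
        (Filter.Eventually.of_forall fun u => Real.exp_nonneg _),
      ← ENNReal.ofReal_mul (integral_nonneg fun _ => Real.exp_nonneg _)]
    refine ENNReal.ofReal_le_ofReal ?_
    refine (mul_le_mul_of_nonneg_right (hX.mgf_le t) (Real.exp_nonneg _)).trans ?_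
    rw [← Real.exp_add]
    refine (congrArg Real.exp ?_).le
    push_cast
    ring
  have hint : ∀ t : ℝ, Integrable (fun p => Real.exp (t * ψ p)) (μ.prod ν) := by
    intro t
    refine ⟨by fun_prop, ?_⟩
    rw [hasFiniteIntegral_iff_ofReal (Filter.Eventually.of_forall fun u => Real.exp_nonneg _)]
    exact (hbound t).trans_lt ENNReal.ofReal_lt_top
  refine ⟨hint, fun t => ?_⟩
  rw [← ENNReal.ofReal_le_ofReal_iff (Real.exp_nonneg _), mgf,
    ofReal_integral_eq_lintegral_ofReal (hint t)
      (Filter.Eventually.of_forall fun u => Real.exp_nonneg _)]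
  exact hbound t

theorem ProbabilityTheory.HasSubgaussianMGF.measure_sq_gt_le {Ω : Type*} [MeasurableSpace Ω]
    {P : Measure Ω} [IsProbabilityMeasure P] {X : Ω → ℝ} {c : ℝ≥0}
    (hX : HasSubgaussianMGF X c P) {l : ℝ} (hl : 0 ≤ l) :
    P.real {ω | 2 * c * l < X ω ^ 2} ≤ 2 * Real.exp (-l) := by
  -- With zero proxy the Chernoff exponent would divide by zero, but the variable vanishes almost
  -- surely.
  rcases eq_or_ne c 0 with rfl | hc
  · have h0 := hX.ae_eq_zero_of_hasSubgaussianMGF_zero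
    have : P.real {ω | 2 * ((0 : ℝ≥0) : ℝ) * l < X ω ^ 2} = 0 := by
      rw [measureReal_eq_zero_iff]
      refine measure_mono_null (fun ω hω => ?_) h0
      intro h
      simp only [Set.mem_ofPred_eq] at hω
      simp only [Pi.zero_apply] at h
      rw [h] at hω
      simp at hω
    rw [this]
    positivity
  have hc0 : (0 : ℝ) < c := by positivity
  set e := √(2 * c * l) with he
  have hee : e ^ 2 = 2 * c * l := Real.sq_sqrt (by positivity)
  have he0 : 0 ≤ e := Real.sqrt_nonneg _
  have hexp : Real.exp (-e ^ 2 / (2 * c)) = Real.exp (-l) := by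
    rw [hee]; congr 1; field_simp
  have h1 := hX.measure_ge_le he0
  have h2 := hX.neg.measure_ge_le he0
  rw [hexp] at h1 h2
  calc P.real {ω | 2 * c * l < X ω ^ 2}
      ≤ P.real ({ω | e ≤ X ω} ∪ {ω | e ≤ (-X) ω}) := by
        refine measureReal_mono fun ω hω => ?_
        simp only [Set.mem_ofPred_eq, ← hee] at hω
        have h := (sq_lt_sq.mp hω).le
        rw [abs_of_nonneg he0] at h
        exact le_abs.mp h
    _ ≤ _ := (measureReal_union_le _ _).trans (by linarith)

namespace SparseRegression

variable {d : ℕ} {D : Measure (Vec d × ℝ)} {θstar : Vec d} {σ : ℝ≥0} {R : ℝ}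

/-- The deviation of a single-example gradient coordinate from its mean. -/
noncomputable def gradDev (D : Measure (Vec d × ℝ)) (θstar θ : Vec d) (j : Fin d)
    (z : Vec d × ℝ) : ℝ :=
  2 * (inner ℝ θ z.1 - z.2) * z.1 j - riskGrad D θstar θ j

/-- A variance proxy of `gradDev`. -/
noncomputable def gradProxy (R : ℝ) (σ : ℝ≥0) (v : Vec d) : ℝ≥0 :=
  (2 * R.toNNReal ^ 2 * ∑ j, ‖v j‖₊) ^ 2 + (2 * R.toNNReal) ^ 2 * σ ^ 2

/-- Since `x` and `ξ` are independent, their joint law is a product, and the deviation is `A x - E A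
+ b x * ξ` with `A x = 2⟨θ - θ_*, x⟩ x_j` and `b x = -2 x_j`, both bounded. -/
theorem IsLinearModel.hasSubgaussianMGF_gradDev (hD : IsLinearModel D θstar σ)
    (hb : BoundedData D R) (hR : 0 ≤ R) (θ : Vec d) (j : Fin d) :
    HasSubgaussianMGF (gradDev D θstar θ j) (gradProxy R σ (θ - θstar)) D := by
  have := hD.prob
  have hres := measurable_residual θstar
  have hmap := hD.indep.map_prod_eq_prod_map_map (by fun_prop) hres.aemeasurable
  have p1 : IsProbabilityMeasure (D.map Prod.fst) :=
    Measure.isProbabilityMeasure_map (by fun_prop)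
  have p2 : IsProbabilityMeasure (D.map (residual θstar)) :=
    Measure.isProbabilityMeasure_map hres.aemeasurable
  have hsub : HasSubgaussianMGF id (σ ^ 2) (D.map (residual θstar)) :=
    (HasSubgaussianMGF.id_map_iff hres.aemeasurable).mpr hD.subGaussian
  set A : Vec d → ℝ := fun x => 2 * inner ℝ (θ - θstar) x * x j with hA
  set b : Vec d → ℝ := fun x => -2 * x j with hbdef
  have hAm : Measurable A := by fun_prop
  have hbm : Measurable b := by fun_prop
  have key := HasSubgaussianMGF.prod_of_bounded (μ := D.map Prod.fst) hAm hbm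
    (M := 2 * R.toNNReal ^ 2 * ∑ j, ‖(θ - θstar) j‖₊) (K := 2 * R.toNNReal) ?_ ?_ hsub
  · rw [← hmap] at key
    have h := key.of_map (Y := fun z : Vec d × ℝ => (z.1, residual θstar z)) (by fun_prop)
    have hmean : (D.map Prod.fst)[A] = riskGrad D θstar θ j := by
      rw [integral_map (by fun_prop) hAm.aestronglyMeasurable]
      rfl
    refine h.congr (Filter.Eventually.of_forall fun z => ?_)
    simp only [Function.comp]
    rw [hmean, gradDev, inner_sub_label θ θstar]
    ring
  · rw [ae_map_iff (by fun_prop) (measurableSet_le (by fun_prop) (by fun_prop))]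
    filter_upwards [hb, hb.abs_inner_le (θ - θstar)] with z hz hz2
    simp only [hA, abs_mul, Nat.abs_ofNat]
    push_cast
    rw [Real.coe_toNNReal _ hR]
    simp only [Real.norm_eq_abs]
    have h0 : 0 ≤ R * ∑ j, |(θ - θstar) j| :=
      mul_nonneg hR (Finset.sum_nonneg fun _ _ => abs_nonneg _)
    calc 2 * |inner ℝ (θ - θstar) z.1| * |z.1 j|
        ≤ 2 * (R * ∑ j, |(θ - θstar) j|) * R := by
          gcongr
          exact hz j
      _ = _ := by ring
  · rw [ae_map_iff (by fun_prop) (measurableSet_le (by fun_prop) (by fun_prop))]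
    filter_upwards [hb] with z hz
    simp only [hbdef, abs_mul, abs_neg, Nat.abs_ofNat]
    push_cast
    rw [Real.coe_toNNReal _ hR]
    linarith [hz j]

theorem gradProxy_le (hR : 0 ≤ R) (v : Vec d) (s : ℕ) (hv : l0 v ≤ 2 * s) :
    (gradProxy R σ v : ℝ) ≤ 8 * R ^ 4 * s * ‖v‖ ^ 2 + 4 * R ^ 2 * σ ^ 2 := by
  have h := sum_abs_sq_le v (2 * s) hv
  have : (gradProxy R σ v : ℝ) = 4 * R ^ 4 * (∑ j, |v j|) ^ 2 + 4 * R ^ 2 * σ ^ 2 := by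
    simp only [gradProxy]
    push_cast
    rw [Real.coe_toNNReal _ hR]
    simp only [Real.norm_eq_abs]
    ring
  rw [this]
  push_cast at h
  have h2 : 4 * R ^ 4 * (∑ j, |v j|) ^ 2 ≤ 4 * R ^ 4 * (2 * s * ‖v‖ ^ 2) := by gcongr
  linarith

/-- Blanking loses nothing: the prediction needs only the support of `θ`, and coordinate `j` lies in
the block where it is estimated. -/
theorem gradEstimator_apply (s' s B : ℕ) (hs : s < s') (Z : ℕ → ℕ → Vec d × ℝ) (θ : Vec d)
    (j : Fin d) :
    gradEstimator s' s B Z θ j = (1 / (B : ℝ)) * ∑ b ∈ Finset.range B,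
      2 * (inner ℝ θ (Z ((j : ℕ) / (s' - s)) b).1 - (Z ((j : ℕ) / (s' - s)) b).2)
        * (Z ((j : ℕ) / (s' - s)) b).1 j := by
  classical
  have hpos : 0 < s' - s := by omega
  simp only [gradEstimator]
  congr 1
  refine Finset.sum_congr rfl fun b _ => ?_
  have hj : j ∈ block d s' s ((j : ℕ) / (s' - s)) := by
    simp only [block, Finset.mem_filter, Finset.mem_univ, true_and]
    exact ⟨Nat.mul_div_le _ _, Nat.lt_mul_div_succ _ hpos⟩
  generalize Z ((j : ℕ) / (s' - s)) b = z
  have h1 : ∑ k ∈ supp θ, θ k * observe (block d s' s ((j : ℕ) / (s' - s)) ∪ supp θ) z.1 k =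
      inner ℝ θ z.1 := by
    rw [inner_eq_sum, ← Finset.sum_subset (Finset.subset_univ (supp θ))]
    · refine Finset.sum_congr rfl fun k hk => ?_
      simp [observe, hk]
    · intro k _ hk
      simp only [mem_supp, not_not] at hk
      simp [hk]
  rw [h1]
  simp [observe, hj]

theorem gradEstimator_sub_riskGrad (s' s B : ℕ) (hs : s < s') (hB : 1 ≤ B)
    (Z : ℕ → ℕ → Vec d × ℝ) (θ : Vec d) (j : Fin d) :
    gradEstimator s' s B Z θ j - riskGrad D θstar θ j =
      (∑ b ∈ Finset.range B, gradDev D θstar θ j (Z ((j : ℕ) / (s' - s)) b)) / B := by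
  have hB0 : (B : ℝ) ≠ 0 := by positivity
  rw [gradEstimator_apply s' s B hs]
  simp only [gradDev, Finset.sum_sub_distrib, Finset.sum_const, Finset.card_range, nsmul_eq_mul]
  field_simp

/-- Tail bound for the average over a batch at a fixed parameter. -/
theorem IsLinearModel.measure_gradDev_sum_le (hD : IsLinearModel D θstar σ)
    (hb : BoundedData D R) (hR : 0 ≤ R) {Ω : Type*} [MeasurableSpace Ω] {P : Measure Ω}
    [IsProbabilityMeasure P] {X : ℕ → Ω → Vec d × ℝ} (hX : ∀ n, Measurable (X n))
    (hlaw : ∀ n, P.map (X n) = D) (hind : iIndepFun X P) (θ : Vec d) (j : Fin d) (B : ℕ) {l : ℝ}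
    (hl : 0 ≤ l) :
    P.real {ω | 2 * (B * (gradProxy R σ (θ - θstar) : ℝ)) * l <
      (∑ b ∈ Finset.range B, gradDev D θstar θ j (X b ω)) ^ 2} ≤ 2 * Real.exp (-l) := by
  have hm : Measurable (gradDev D θstar θ j) := by unfold gradDev; fun_prop
  have hsub : ∀ n, HasSubgaussianMGF (gradDev D θstar θ j ∘ X n)
      (gradProxy R σ (θ - θstar)) P := fun n =>
    HasSubgaussianMGF.of_map (hX n).aemeasurable
      (by rw [hlaw n]; exact hD.hasSubgaussianMGF_gradDev hb hR θ j)
  have hsum := HasSubgaussianMGF.sum_of_iIndepFun (s := Finset.range B)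
    (hind.comp (fun _ => gradDev D θstar θ j) fun _ => hm) (c := fun _ => gradProxy R σ (θ - θstar))
    fun n _ => hsub n
  have := hsum.measure_sq_gt_le hl
  simpa using this

end SparseRegression

/-! ### Random iterates: adaptedness, independence and the union bound -/

namespace SparseRegression

variable {d : ℕ} {D : Measure (Vec d × ℝ)} {θstar : Vec d} {σ : ℝ≥0} {R : ℝ}

theorem measurable_gradEstimator {Ω : Type*} [MeasurableSpace Ω] {s' s B : ℕ} (hs : s < s')
    {θ : Ω → Vec d} {Y : ℕ → ℕ → Ω → Vec d × ℝ} (hθ : Measurable θ)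
    (hY : ∀ i b, Measurable (Y i b)) :
    Measurable fun ω => gradEstimator s' s B (fun i b => Y i b ω) (θ ω) := by
  have h : ∀ j, Measurable fun ω => gradEstimator s' s B (fun i b => Y i b ω) (θ ω) j := by
    intro j
    simp_rw [gradEstimator_apply s' s B hs]
    fun_prop
  have h2 := (by fun_prop : Measurable (WithLp.toLp 2 : (Fin d → ℝ) → Vec d)).comp
    (measurable_pi_iff.mpr h)
  exact h2

/-- Adaptedness: the iterate depends only on examples of rounds up to `t`, which makes it
independent of those of round `t + 1`. -/
theorem measurable_exploration {Ω : Type*} {H : Vec d → Vec d} (hH : Measurable H) (η : ℝ)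
    {s' s : ℕ} (hs : s < s') (B : ℕ → ℕ) (Z : ℕ × ℕ × ℕ → Ω → Vec d × ℝ) (θ₀ : Vec d) (t : ℕ) :
    Measurable[⨆ n ∈ {n : ℕ × ℕ × ℕ | n.1 ≤ t}, MeasurableSpace.comap (Z n) inferInstance]
      fun ω => exploration H η s' s B (fun n => Z n ω) θ₀ t := by
  induction t with
  | zero => exact measurable_const
  | succ t ih =>
    set m := ⨆ n ∈ {n : ℕ × ℕ × ℕ | n.1 ≤ t + 1}, MeasurableSpace.comap (Z n) inferInstance
      with hm
    have hθ : Measurable[m] fun ω => exploration H η s' s B (fun n => Z n ω) θ₀ t := by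
      refine ih.mono ?_ le_rfl
      exact biSup_mono fun n (hn : n.1 ≤ t) => show n.1 ≤ t + 1 by omega
    have hZ : ∀ i b, Measurable[m] (Z (t + 1, i, b)) := by
      intro i b
      refine (comap_measurable (Z (t + 1, i, b))).mono ?_ le_rfl
      exact le_biSup (fun n => MeasurableSpace.comap (Z n) inferInstance)
        (by simp : (t + 1, i, b) ∈ {n : ℕ × ℕ × ℕ | n.1 ≤ t + 1})
    clear_value m
    have hg := measurable_gradEstimator (B := B (t + 1)) hs hθ hZ
    exact hH.comp (hθ.sub (hg.const_smul η))

theorem measurable_riskGrad [IsProbabilityMeasure D] (j : Fin d) :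
    Measurable fun θ => riskGrad D θstar θ j := by
  have h : StronglyMeasurable fun p : Vec d × (Vec d × ℝ) =>
      2 * inner ℝ (p.1 - θstar) p.2.1 * p.2.1 j :=
    Measurable.stronglyMeasurable (by fun_prop)
  exact h.integral_prod_right.measurable

/-- The tail bound for the gradient estimator at the random iterate of round `t`, which is
independent of the examples of round `t + 1`. -/
theorem IsLinearModel.measure_gradDev_exploration_le (hD : IsLinearModel D θstar σ)
    (hb : BoundedData D R) (hR : 0 ≤ R) {H : Vec d → Vec d} (hH : Measurable H) (η : ℝ)
    {s' s : ℕ} (hs : s < s') (B : ℕ → ℕ) (θ₀ : Vec d)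
    {Ω : Type*} [MeasurableSpace Ω] {P : Measure Ω} [IsProbabilityMeasure P]
    {Z : ℕ × ℕ × ℕ → Ω → Vec d × ℝ} (hZ : ∀ n, Measurable (Z n)) (hlaw : ∀ n, P.map (Z n) = D)
    (hind : iIndepFun Z P) (t i : ℕ) (j : Fin d) {l : ℝ} (hl : 0 ≤ l) :
    P.real {ω |
      2 * (B (t + 1) * (gradProxy R σ
        (exploration H η s' s B (fun n => Z n ω) θ₀ t - θstar) : ℝ)) * l <
      (∑ b ∈ Finset.range (B (t + 1)),
        gradDev D θstar (exploration H η s' s B (fun n => Z n ω) θ₀ t) j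
          (Z (t + 1, i, b) ω)) ^ 2} ≤ 2 * Real.exp (-l) := by
  have := hD.prob
  set ϑ : Ω → Vec d := fun ω => exploration H η s' s B (fun n => Z n ω) θ₀ t with hϑ
  set W : Ω → ℕ → Vec d × ℝ := fun ω b => Z (t + 1, i, b) ω with hW
  have hle : ∀ n, MeasurableSpace.comap (Z n) inferInstance ≤ ‹MeasurableSpace Ω› :=
    fun n => (hZ n).comap_le
  have hϑpast := measurable_exploration hH η hs B Z θ₀ t
  have hϑm : Measurable ϑ := hϑpast.mono (iSup₂_le fun n _ => hle n) le_rfl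
  have hWm : Measurable W := measurable_pi_iff.mpr fun b => hZ _
  have hWfresh : Measurable[⨆ n ∈ {n : ℕ × ℕ × ℕ | n.1 = t + 1},
      MeasurableSpace.comap (Z n) inferInstance] W := by
    refine @measurable_pi_lambda _ _ _ (_) _ _ fun b => ?_
    refine (comap_measurable (Z (t + 1, i, b))).mono ?_ le_rfl
    exact le_biSup (fun n => MeasurableSpace.comap (Z n) inferInstance)
      (by simp : (t + 1, i, b) ∈ {n : ℕ × ℕ × ℕ | n.1 = t + 1})
  have hindep : IndepFun ϑ W P := by
    have h := indep_iSup_of_disjoint hle hind.iIndep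
      (S := {n : ℕ × ℕ × ℕ | n.1 ≤ t}) (T := {n : ℕ × ℕ × ℕ | n.1 = t + 1}) (by
        rw [Set.disjoint_left]
        rintro n (h1 : n.1 ≤ t) (h2 : n.1 = t + 1)
        omega)
    exact indep_of_indep_of_le_left (indep_of_indep_of_le_right h hWfresh.comap_le)
      hϑpast.comap_le
  have hmap := hindep.map_prod_eq_prod_map_map hϑm.aemeasurable hWm.aemeasurable
  set S : Set (Vec d × (ℕ → Vec d × ℝ)) := {p |
    2 * (B (t + 1) * (gradProxy R σ (p.1 - θstar) : ℝ)) * l <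
      (∑ b ∈ Finset.range (B (t + 1)), gradDev D θstar p.1 j (p.2 b)) ^ 2} with hS
  have hSm : MeasurableSet S := by
    refine measurableSet_lt ?_ ?_
    · unfold gradProxy; fun_prop
    · have hr : Measurable fun p : Vec d × (ℕ → Vec d × ℝ) => riskGrad D θstar p.1 j :=
        (measurable_riskGrad j).comp measurable_fst
      unfold gradDev
      refine (Finset.measurable_fun_sum _ fun b _ => Measurable.sub ?_ hr).pow_const 2
      fun_prop
  have p1 : IsProbabilityMeasure (P.map ϑ) := Measure.isProbabilityMeasure_map hϑm.aemeasurable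
  have p2 : IsProbabilityMeasure (P.map W) := Measure.isProbabilityMeasure_map hWm.aemeasurable
  change P.real ((fun ω => (ϑ ω, W ω)) ⁻¹' S) ≤ _
  rw [measureReal_def]
  refine ENNReal.toReal_le_of_le_ofReal (by positivity) ?_
  rw [← Measure.map_apply (hϑm.prodMk hWm) hSm, hmap, Measure.prod_apply hSm]
  -- By Fubini the iterate is frozen at a fixed `θ`, where the tail bound holds uniformly.
  calc ∫⁻ θ, P.map W (Prod.mk θ ⁻¹' S) ∂(P.map ϑ)
      ≤ ∫⁻ _, ENNReal.ofReal (2 * Real.exp (-l)) ∂(P.map ϑ) := by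
        refine lintegral_mono fun θ => ?_
        rw [Measure.map_apply hWm (measurable_prodMk_left hSm)]
        refine (ENNReal.le_ofReal_iff_toReal_le (measure_ne_top _ _) (by positivity)).mpr ?_
        exact hD.measure_gradDev_sum_le hb hR (X := fun b => Z (t + 1, i, b)) (fun b => hZ _)
          (fun b => hlaw _)
          (hind.precomp (g := fun b : ℕ => (t + 1, i, b)) fun a b h => by simpa using h) θ j
          (B (t + 1)) hl
    _ = _ := by simp

/-- With high probability, all gradient estimates of the first `T` rounds are accurate in every
coordinate. -/
theorem IsLinearModel.measure_accurate_ge (hD : IsLinearModel D θstar σ)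
    (hb : BoundedData D R) (hR : 0 ≤ R) {H : Vec d → Vec d} (hH : Measurable H) (η : ℝ)
    {s' s : ℕ} (hs : s < s') (B : ℕ → ℕ) (hB : ∀ t, 1 ≤ B t) (θ₀ : Vec d)
    {Ω : Type*} [MeasurableSpace Ω] {P : Measure Ω} [IsProbabilityMeasure P]
    {Z : ℕ × ℕ × ℕ → Ω → Vec d × ℝ} (hZ : ∀ n, Measurable (Z n)) (hlaw : ∀ n, P.map (Z n) = D)
    (hind : iIndepFun Z P) (T : ℕ) {l : ℝ} (hl : 0 ≤ l) :
    1 - T * d * (2 * Real.exp (-l)) ≤ P.real {ω | ∀ t < T, ∀ j,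
      (gradEstimator s' s (B (t + 1)) (fun i b => Z (t + 1, i, b) ω)
          (exploration H η s' s B (fun n => Z n ω) θ₀ t) j
        - gradient (risk D) (exploration H η s' s B (fun n => Z n ω) θ₀ t) j) ^ 2 ≤
      2 * (gradProxy R σ (exploration H η s' s B (fun n => Z n ω) θ₀ t - θstar) : ℝ) * l
        / B (t + 1)} := by
  have := hD.prob
  set bad : ℕ → Fin d → Set Ω := fun t j => {ω |
      2 * (B (t + 1) * (gradProxy R σ
        (exploration H η s' s B (fun n => Z n ω) θ₀ t - θstar) : ℝ)) * l <
      (∑ b ∈ Finset.range (B (t + 1)),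
        gradDev D θstar (exploration H η s' s B (fun n => Z n ω) θ₀ t) j
          (Z (t + 1, (j : ℕ) / (s' - s), b) ω)) ^ 2} with hbad
  set G := {ω | ∀ t < T, ∀ j,
      (gradEstimator s' s (B (t + 1)) (fun i b => Z (t + 1, i, b) ω)
          (exploration H η s' s B (fun n => Z n ω) θ₀ t) j
        - gradient (risk D) (exploration H η s' s B (fun n => Z n ω) θ₀ t) j) ^ 2 ≤
      2 * (gradProxy R σ (exploration H η s' s B (fun n => Z n ω) θ₀ t - θstar) : ℝ) * l
        / B (t + 1)} with hG
  have hcover : Set.univ ⊆ G ∪ ⋃ t ∈ Finset.range T, ⋃ j ∈ (Finset.univ : Finset (Fin d)),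
      bad t j := by
    intro ω _
    by_cases h : ∃ t < T, ∃ j, ω ∈ bad t j
    · obtain ⟨t, ht, j, hj⟩ := h
      right
      simp only [Set.mem_iUnion, Finset.mem_range, Finset.mem_univ, exists_prop, true_and]
      exact ⟨t, ht, j, hj⟩
    · left
      intro t ht j
      have hgood : ω ∉ bad t j := fun h' => h ⟨t, ht, j, h'⟩
      simp only [hbad, Set.mem_ofPred_eq, not_lt] at hgood
      have hB0 : (0 : ℝ) < B (t + 1) := by exact_mod_cast hB (t + 1)
      rw [hD.gradient_risk hb, gradEstimator_sub_riskGrad s' s _ hs (hB _), div_pow,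
        div_le_div_iff₀ (by positivity) hB0]
      nlinarith
  have h1 : (1 : ℝ) ≤ P.real G + T * d * (2 * Real.exp (-l)) := by
    calc (1 : ℝ) = P.real Set.univ := by simp
      _ ≤ P.real (G ∪ ⋃ t ∈ Finset.range T, ⋃ j ∈ (Finset.univ : Finset (Fin d)), bad t j) :=
        measureReal_mono hcover
      _ ≤ P.real G + P.real (⋃ t ∈ Finset.range T, ⋃ j ∈ (Finset.univ : Finset (Fin d)),
          bad t j) := measureReal_union_le _ _
      _ ≤ P.real G + ∑ t ∈ Finset.range T, ∑ j : Fin d, P.real (bad t j) := by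
        gcongr
        refine (measureReal_biUnion_finset_le _ _).trans (Finset.sum_le_sum fun t _ => ?_)
        exact measureReal_biUnion_finset_le _ _
      _ ≤ P.real G + ∑ t ∈ Finset.range T, ∑ j : Fin d, 2 * Real.exp (-l) := by
        gcongr with t _ j _
        exact hD.measure_gradDev_exploration_le hb hR hH η hs B θ₀ hZ hlaw hind t _ j hl
      _ = _ := by simp; ring
  linarith

end SparseRegression

/-! ### Linear convergence, number of rounds and sample budget -/

namespace SparseRegression

variable {d : ℕ} {D : Measure (Vec d × ℝ)} {θstar : Vec d} {σ : ℝ≥0} {R : ℝ}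

theorem IsHardThresholding.l0_exploration_le {s s' : ℕ} {H : Vec d → Vec d}
    (hH : IsHardThresholding s H) (η : ℝ) (B : ℕ → ℕ) (Z : ℕ × ℕ × ℕ → Vec d × ℝ) (θ₀ : Vec d)
    (t : ℕ) : l0 (exploration H η s' s B Z θ₀ t) ≤ s := by
  cases t <;> exact hH.sparse _

/-- Linear convergence of the iterates, up to the label noise, as long as all gradient estimates
are accurate. -/
theorem IsLinearModel.exploration_gap_le (hD : IsLinearModel D θstar σ) (hb : BoundedData D R)
    (hR : 0 ≤ R) {s s' : ℕ} {L μ κ : ℝ} {H : Vec d → Vec d} (hH : IsHardThresholding s H)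
    (hs : 1 ≤ s) (hL : 0 < L) (hμ : 0 < μ) (hsm : RestrictedSmooth (risk D) s L)
    (hsc : RestrictedStronglyConvex (risk D) s μ) (hκ : κ = L / μ) (hκ1 : 1 ≤ κ)
    (hstar : 64 * κ ^ 2 * (l0 θstar : ℝ) ≤ s) (B : ℕ) (θ₀ : Vec d)
    (Z : ℕ × ℕ × ℕ → Vec d × ℝ) (T : ℕ) {l : ℝ} (hl : 0 ≤ l) (hB0 : 1 ≤ B)
    (hB : 1280 * l * (κ ^ 2 * (R ^ 4 / L ^ 2) * (s : ℝ) ^ 2) ≤ B)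
    (hacc : ∀ t < T, ∀ j,
      (gradEstimator s' s B (fun i b => Z (t + 1, i, b))
          (exploration H (1 / 2 / L) s' s (fun _ => B) Z θ₀ t) j
        - gradient (risk D) (exploration H (1 / 2 / L) s' s (fun _ => B) Z θ₀ t) j) ^ 2 ≤
      2 * (gradProxy R σ
        (exploration H (1 / 2 / L) s' s (fun _ => B) Z θ₀ t - θstar) : ℝ) * l / B) :
    risk D (exploration H (1 / 2 / L) s' s (fun _ => B) Z θ₀ T) - risk D θstar ≤
      (1 - 1 / 32 / κ) ^ T * (risk D (H θ₀) - risk D θstar)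
        + T * (10 * s * R ^ 2 * σ ^ 2 * l / (L * B)) := by
  have hBpos : (0 : ℝ) < B := by exact_mod_cast hB0
  have hκ0 : 0 < κ := by linarith
  have hLκ : L = κ * μ := by rw [hκ]; field_simp
  have hα : 1 / 32 / κ ≤ 1 := by rw [div_le_one hκ0]; linarith
  have hα0 : 0 ≤ 1 - 1 / 32 / κ := by linarith
  have hα1 : 1 - 1 / 32 / κ ≤ 1 := by
    have : 0 ≤ 1 / 32 / κ := by positivity
    linarith
  have hgrad : gradient (risk D) θstar = 0 := by rw [hD.gradient_risk hb, riskGrad_self]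
  have hle : l0 θstar ≤ s := by
    have hl0 : (0 : ℝ) ≤ l0 θstar := by positivity
    have : (l0 θstar : ℝ) ≤ s := by
      nlinarith [mul_le_mul_of_nonneg_right (one_le_pow₀ hκ1 : 1 ≤ κ ^ 2) hl0]
    exact_mod_cast this
  set N : ℝ := 10 * s * R ^ 2 * σ ^ 2 * l / (L * B) with hN
  have hN0 : 0 ≤ N := by positivity
  induction T with
  | zero => simp [exploration]
  | succ T ih =>
    specialize ih fun t ht => hacc t (by omega)
    have hsp := hH.l0_exploration_le (s' := s') (1 / 2 / L) (fun _ => B) Z θ₀ T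
    specialize hacc T (by omega)
    have hrec : exploration H (1 / 2 / L) s' s (fun _ => B) Z θ₀ (T + 1) =
        H (exploration H (1 / 2 / L) s' s (fun _ => B) Z θ₀ T - (1 / 2 / L) •
          gradEstimator s' s B (fun i b => Z (T + 1, i, b))
            (exploration H (1 / 2 / L) s' s (fun _ => B) Z θ₀ T)) := rfl
    rw [hrec]
    generalize exploration H (1 / 2 / L) s' s (fun _ => B) Z θ₀ T = θ at hacc hsp ih ⊢
    generalize gradEstimator s' s B (fun i b => Z (T + 1, i, b)) θ = g at hacc ⊢
    have hdist : ‖θ - θstar‖ ^ 2 ≤ 2 / μ * (risk D θ - risk D θstar) := by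
      have := hsc θ θstar hsp hle
      rw [hgrad, inner_zero_left] at this
      rw [div_mul_eq_mul_div, le_div_iff₀ hμ]
      linarith
    set gap := risk D θ - risk D θstar with hgap
    have hgap0 : 0 ≤ gap := by
      have h1 : 0 ≤ 2 / μ * gap := (sq_nonneg _).trans hdist
      exact nonneg_of_mul_nonneg_right h1 (by positivity)
    have hproxy : (gradProxy R σ (θ - θstar) : ℝ) ≤
        16 * R ^ 4 * s / μ * gap + 4 * R ^ 2 * σ ^ 2 := by
      refine (gradProxy_le hR _ s ((l0_sub_le _ _).trans (by omega))).trans ?_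
      have : 8 * R ^ 4 * s * ‖θ - θstar‖ ^ 2 ≤ 8 * R ^ 4 * s * (2 / μ * gap) := by gcongr
      refine (add_le_add_left this _).trans (le_of_eq ?_)
      ring
    set E : ℝ := 2 * (16 * R ^ 4 * s / μ * gap + 4 * R ^ 2 * σ ^ 2) * l / B with hE
    have hE0 : 0 ≤ E := by positivity
    have hstep := risk_step_le hH hs hL hμ hsm hsc (hκ ▸ hκ1) hgrad (hκ ▸ hstar) (g := g) hsp hE0
      fun j => (hacc j).trans (by rw [hE]; gcongr)
    rw [← hκ, ← hgap] at hstep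
    have hEN : 5 / 4 * (s * E) / L = 40 * R ^ 4 * s ^ 2 * l / (L * μ * B) * gap + N := by
      rw [hE, hN]; field_simp; ring
    -- Here `1280 = 40 * 32`: the gap-proportional error uses up half of the contraction `1 /
    -- (16κ)`, leaving the rate `1 / (32κ)`.
    have hfirst : 40 * R ^ 4 * s ^ 2 * l / (L * μ * B) ≤ 1 / 32 / κ := by
      rw [div_div, div_le_div_iff₀ (by positivity) (by positivity)]
      have h1 : 1280 * l * (κ ^ 2 * (R ^ 4 / L ^ 2) * (s : ℝ) ^ 2) * (L * μ) =
          40 * R ^ 4 * s ^ 2 * l * (32 * κ) := by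
        rw [hLκ]; field_simp; ring
      rw [← h1, one_mul, mul_comm (L * μ)]
      gcongr
    have h16 : 1 / (16 * κ) = 2 * (1 / 32 / κ) := by field_simp; ring
    have h2 : 40 * R ^ 4 * s ^ 2 * l / (L * μ * B) * gap ≤ 1 / 32 / κ * gap := by gcongr
    rw [hEN, h16] at hstep
    have h3 := mul_le_mul_of_nonneg_left ih hα0
    -- The noise is added up without using its geometric decay, whence the factor `T` in the second
    -- batch-size term.
    have h4 : (1 - 1 / 32 / κ) * (T * N) ≤ T * N :=
      mul_le_of_le_one_left (by positivity) hα1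
    push_cast
    rw [pow_succ]
    linarith

/-- Take the least `T` reaching the accuracy. Failure at `T - 1` bounds `T` and also shows that `(1
- α) ^ T` is not much smaller than `ε / Δ`, which controls the batch size. -/
theorem exists_rounds {α Δ ε : ℝ} (hα0 : 0 < α) (hα : α ≤ 1 / 32) (hε : 0 < ε) (hΔ : ε < Δ) :
    ∃ T : ℕ, 1 ≤ T ∧ 2 * (1 - α) ^ T * Δ ≤ ε ∧ ε ≤ 3 * Δ * (1 - α) ^ T ∧
      (T : ℝ) ≤ 33 / 32 * accuracyLog Δ ε / α := by
  classical
  have hΔ0 : 0 < Δ := hε.trans hΔ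
  have hex : ∃ T : ℕ, 2 * (1 - α) ^ T * Δ ≤ ε := by
    obtain ⟨T, hT⟩ := exists_pow_lt_of_lt_one (y := 1 - α)
      (show 0 < ε / (2 * Δ) by positivity) (by linarith)
    refine ⟨T, ?_⟩
    rw [lt_div_iff₀ (by positivity)] at hT
    linarith
  obtain ⟨n, hn⟩ : ∃ n, Nat.find hex = n + 1 := by
    refine Nat.exists_eq_succ_of_ne_zero fun h0 => ?_
    have := Nat.find_spec hex
    rw [h0] at this
    simp at this
    linarith
  have hmin : ε < 2 * (1 - α) ^ n * Δ := by
    have := Nat.find_min hex (m := n) (by omega)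
    linarith
  have hspec := Nat.find_spec hex
  rw [hn] at hspec
  refine ⟨n + 1, by omega, hspec, ?_, ?_⟩
  · rw [pow_succ]
    have h1 : 0 ≤ (1 - α) ^ n * Δ := mul_nonneg (pow_nonneg (by linarith) _) hΔ0.le
    nlinarith
  · have hlog : 0 ≤ Real.log (Δ / ε) := Real.log_nonneg (by rw [le_div_iff₀ hε]; linarith)
    have hacc : accuracyLog Δ ε = 1 + Real.log (Δ / ε) := by
      rw [accuracyLog, max_eq_right hlog]
    have h1 : (1 - α) ^ n ≤ Real.exp (-(α * n)) := by
      have h2 : 1 - α ≤ Real.exp (-α) := by linarith [Real.add_one_le_exp (-α)]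
      calc (1 - α) ^ n ≤ Real.exp (-α) ^ n := pow_le_pow_left₀ (by linarith) h2 n
        _ = _ := by rw [← Real.exp_nat_mul]; ring_nf
    have h3 : Real.exp (α * n) ≤ 2 * (Δ / ε) := by
      rw [mul_div_assoc', le_div_iff₀ hε]
      have h4 : Real.exp (α * n) * Real.exp (-(α * n)) = 1 := by
        rw [← Real.exp_add]; simp
      calc Real.exp (α * n) * ε ≤ Real.exp (α * n) * (2 * Real.exp (-(α * n)) * Δ) := by
            gcongr
            exact hmin.le.trans (by gcongr)
        _ = 2 * Δ * (Real.exp (α * n) * Real.exp (-(α * n))) := by ring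
        _ = 2 * Δ := by rw [h4, mul_one]
    have h5 : α * n ≤ Real.log 2 + Real.log (Δ / ε) := by
      rw [← Real.log_mul (by norm_num) (by positivity)]
      exact (Real.le_log_iff_exp_le (by positivity)).mpr h3
    have h6 := Real.log_two_lt_d9
    rw [le_div_iff₀ hα0, hacc]
    push_cast
    nlinarith

theorem numBlocks_le {s s' : ℕ} (hs : s < s') (hd : s' ≤ d) :
    (numBlocks d s' s : ℝ) ≤ 2 * ((d : ℝ) / ((s' : ℝ) - s)) := by
  have h1 : (0 : ℝ) < (s' : ℝ) - s := by
    have : (s : ℝ) < s' := by exact_mod_cast hs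
    linarith
  have h2 : (1 : ℝ) ≤ (d : ℝ) / ((s' : ℝ) - s) := by
    rw [le_div_iff₀ h1]
    have : (s' : ℝ) ≤ d := by exact_mod_cast hd
    have : (0 : ℝ) ≤ s := by positivity
    linarith
  have := (Nat.ceil_lt_add_one (show (0 : ℝ) ≤ (d : ℝ) / ((s' : ℝ) - s) by linarith)).le
  unfold numBlocks
  linarith

theorem one_le_accuracyLog (Δ ε : ℝ) : 1 ≤ accuracyLog Δ ε := by
  unfold accuracyLog
  linarith [le_max_left 0 (Real.log (Δ / ε))]

theorem two_le_confidence_arg {κ δ : ℝ} (hκ : 1 ≤ κ) (hd : 2 ≤ d) (hδ0 : 0 < δ) (hδ1 : δ < 1)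
    (Δ ε : ℝ) : 2 ≤ κ * d / δ * accuracyLog Δ ε := by
  have h1 := one_le_accuracyLog Δ ε
  have hd' : (2 : ℝ) ≤ d := by exact_mod_cast hd
  have h2 : 2 ≤ κ * d / δ := by
    rw [le_div_iff₀ hδ0]
    nlinarith
  nlinarith

theorem half_le_confidenceLog {κ δ : ℝ} (hκ : 1 ≤ κ) (hd : 2 ≤ d) (hδ0 : 0 < δ) (hδ1 : δ < 1)
    (Δ ε : ℝ) : 1 / 2 ≤ confidenceLog κ d δ Δ ε := by
  have h := Real.log_le_log two_pos (two_le_confidence_arg hκ hd hδ0 hδ1 Δ ε)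
  have := Real.log_two_gt_d9
  unfold confidenceLog
  linarith

/-- The logarithmic factor of the union bound over rounds, coordinates and signs. -/
theorem log_union_le {κ δ : ℝ} (hκ : 1 ≤ κ) (hd : 2 ≤ d) (hδ0 : 0 < δ) (hδ1 : δ < 1)
    (Δ ε : ℝ) {T : ℕ} (hT1 : 1 ≤ T) (hT : (T : ℝ) ≤ 33 * κ * accuracyLog Δ ε) :
    Real.log (2 * d * T / δ) ≤ 8 * confidenceLog κ d δ Δ ε := by
  have hq := two_le_confidence_arg hκ hd hδ0 hδ1 Δ ε
  have hd0 : (0 : ℝ) < d := by positivity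
  have hT0 : (0 : ℝ) < T := by exact_mod_cast hT1
  have h66 : 2 * d * T / δ ≤ 66 * (κ * d / δ * accuracyLog Δ ε) := by
    calc 2 * d * T / δ ≤ 2 * d * (33 * κ * accuracyLog Δ ε) / δ := by gcongr
      _ = _ := by ring
  unfold confidenceLog
  set q := κ * d / δ * accuracyLog Δ ε
  -- As `q ≥ 2`, constants inside the logarithm are absorbed into powers of `q`, costing only the
  -- factor 8.
  have h7 : (66 : ℝ) ≤ q ^ 7 := by
    calc (66 : ℝ) ≤ 2 ^ 7 := by norm_num
      _ ≤ q ^ 7 := by gcongr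
  have hq0 : 0 < q := by linarith
  have h8 : 2 * d * T / δ ≤ q ^ 8 := by
    calc _ ≤ 66 * q := h66
      _ ≤ q ^ 7 * q := by gcongr
      _ = q ^ 8 := by ring
  calc _ ≤ Real.log (q ^ 8) := Real.log_le_log (by positivity) h8
    _ = _ := by rw [Real.log_pow]; norm_num

/-- The first term in the batch size bound is bounded below. -/
theorem quarter_le_batch_term {s : ℕ} {L μ κ : ℝ} (hs : 1 ≤ s) (hL : 0 < L) (hμ : 0 < μ)
    (hκ : κ = L / μ) (hμR : μ ≤ 2 * R ^ 2) :
    1 / 4 ≤ κ ^ 2 * (R ^ 4 / L ^ 2) * (s : ℝ) ^ 2 := by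
  have h1 : κ ^ 2 * (R ^ 4 / L ^ 2) = (R ^ 2 / μ) ^ 2 := by rw [hκ]; field_simp
  have h2 : 1 / 2 ≤ R ^ 2 / μ := by rw [le_div_iff₀ hμ]; linarith
  have h3 : (1 : ℝ) ≤ (s : ℝ) ^ 2 := one_le_pow₀ (by exact_mod_cast hs)
  rw [h1]
  nlinarith [mul_le_mul h2 h2 (by norm_num) (by linarith)]

/-- Sample count for a constant batch size. -/
theorem sampleCount_const_le {s s' : ℕ} {L μ κ Δ ε : ℝ} (hss : s < s') (hd : s' ≤ d)
    (hL : 0 < L) (hμ : 0 < μ) (hκ : κ = L / μ) (hε : 0 < ε) (hΔ : 0 < Δ) (B T : ℕ)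
    (hT : (T : ℝ) ≤ 33 * κ * accuracyLog Δ ε) {p K l : ℝ} (hp0 : 0 < p) (hK : 0 ≤ K)
    (hl : 0 ≤ l) (hp : ε ≤ 3 * Δ * p)
    (hB : (B : ℝ) ≤ K * l * max (κ ^ 2 * (R ^ 4 / L ^ 2) * (s : ℝ) ^ 2)
      ((σ : ℝ) ^ 2 / Δ * (R ^ 2 / L) * ((T : ℝ) * (s : ℝ) / p))) :
    (sampleCount d s' s (fun _ => B) T : ℝ) ≤ 6534 * K * l *
      (accuracyLog Δ ε * (κ * R ^ 4 / μ ^ 2 * ((d : ℝ) * (s : ℝ) ^ 2 / ((s' : ℝ) - (s : ℝ)))) +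
        accuracyLog Δ ε ^ 2 * (κ * R ^ 2 / μ * ((d : ℝ) * (s : ℝ) / ((s' : ℝ) - (s : ℝ))) *
          ((σ : ℝ) ^ 2 / ε))) := by
  have hκ0 : 0 < κ := by rw [hκ]; positivity
  have hLκ : L = κ * μ := by rw [hκ]; field_simp
  have hΛ := one_le_accuracyLog Δ ε
  set Λ := accuracyLog Δ ε
  have hw : (0 : ℝ) < (s' : ℝ) - s := by
    have : (s : ℝ) < s' := by exact_mod_cast hss
    linarith
  have hblocks := numBlocks_le hss hd
  set w : ℝ := (s' : ℝ) - s
  have hcount : (sampleCount d s' s (fun _ => B) T : ℝ) = numBlocks d s' s * (T * B) := by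
    simp [sampleCount]; ring
  set A₁ := κ ^ 2 * (R ^ 4 / L ^ 2) * (s : ℝ) ^ 2 with hA₁
  set A₂ := (σ : ℝ) ^ 2 / Δ * (R ^ 2 / L) * ((T : ℝ) * (s : ℝ) / p) with hA₂
  have hA₁0 : 0 ≤ A₁ := by positivity
  have hA₂0 : 0 ≤ A₂ := by positivity
  have hB' : (B : ℝ) ≤ K * l * (A₁ + A₂) :=
    hB.trans (mul_le_mul_of_nonneg_left (max_le_add_of_nonneg hA₁0 hA₂0) (by positivity))
  have hTA₁ : T * A₁ ≤ 33 * (Λ * (κ * R ^ 4 / μ ^ 2 * s ^ 2)) := by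
    calc T * A₁ ≤ 33 * κ * Λ * A₁ := by gcongr
      _ = _ := by rw [hA₁, hLκ]; field_simp
  -- `T` enters twice, as the number of rounds and inside the batch size, hence `Λ ^ 2`; and `1 / p
  -- ≤ 3Δ / ε` trades `Δ` for `ε`. The constant is `3 * 33 ^ 2`.
  have hTA₂ : T * A₂ ≤ 3267 * (Λ ^ 2 * (κ * R ^ 2 / μ * s * (σ ^ 2 / ε))) := by
    have hinv : 1 / p ≤ 3 * Δ / ε := by
      rw [div_le_div_iff₀ hp0 hε]; linarith
    have hT2 : (T : ℝ) ^ 2 ≤ (33 * κ * Λ) ^ 2 := by gcongr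
    calc T * A₂ = σ ^ 2 / Δ * (R ^ 2 / L) * s * ((T : ℝ) ^ 2 * (1 / p)) := by rw [hA₂]; ring
      _ ≤ σ ^ 2 / Δ * (R ^ 2 / L) * s * ((33 * κ * Λ) ^ 2 * (3 * Δ / ε)) := by gcongr
      _ = _ := by rw [hLκ]; field_simp; ring
  rw [hcount]
  calc (numBlocks d s' s : ℝ) * (T * B) ≤ 2 * (d / w) * (T * (K * l * (A₁ + A₂))) := by gcongr
    _ = 2 * (d / w) * (K * l * (T * A₁ + T * A₂)) := by ring
    _ ≤ 2 * (d / w) * (K * l * (3267 * (Λ * (κ * R ^ 4 / μ ^ 2 * s ^ 2)) +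
        3267 * (Λ ^ 2 * (κ * R ^ 2 / μ * s * (σ ^ 2 / ε))))) := by
      have hTA₁' : T * A₁ ≤ 3267 * (Λ * (κ * R ^ 4 / μ ^ 2 * s ^ 2)) :=
        hTA₁.trans (mul_le_mul_of_nonneg_right (by norm_num) (by positivity))
      exact mul_le_mul_of_nonneg_left
        (mul_le_mul_of_nonneg_left (add_le_add hTA₁' hTA₂) (by positivity)) (by positivity)
    _ = _ := by ring

end SparseRegression

/-! ### Choice of rounds and batch size -/

open SparseRegression in
theorem corollary1 :
    -- universal constants: `c₀` for the choice of `s`, `a` for `η`, `c` for the rate `α̌`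
    ∃ c₀ a c C : ℝ, 0 < c₀ ∧ 0 < a ∧ 0 < c ∧ c < 1 ∧ 0 < C ∧
    ∀ (d : ℕ) (D : Measure (Vec d × ℝ)) (θstar : Vec d) (σ : ℝ≥0) (R : ℝ) (s s' : ℕ) (L μ κ : ℝ)
      (H : Vec d → Vec d) (θ₀ : Vec d) (Δ δ ε : ℝ),
      IsLinearModel D θstar σ →
      BoundedData D R →
      1 ≤ s → s < s' → s' ≤ d →
      0 < L → RestrictedSmooth (risk D) s L →
      0 < μ → RestrictedStronglyConvex (risk D) s μ →
      κ = L / μ →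
      c₀ * κ ^ 2 * (l0 θstar : ℝ) ≤ (s : ℝ) →
      IsHardThresholding s H →
      Δ = risk D (H θ₀) - risk D θstar →
      0 < δ → δ < 1 → 0 < ε →
      ∃ (T : ℕ) (B : ℕ → ℕ),
        (∀ t, 1 ≤ B t ∧
          (B t : ℝ) ≤ C * confidenceLog κ d δ Δ ε *
            max (κ ^ 2 * (R ^ 4 / L ^ 2) * (s : ℝ) ^ 2)
              ((σ : ℝ) ^ 2 / Δ * (R ^ 2 / L) * ((T : ℝ) * (s : ℝ) / (1 - c / κ) ^ T))) ∧
        (sampleCount d s' s B T : ℝ) ≤ C * confidenceLog κ d δ Δ ε *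
          (accuracyLog Δ ε *
              (κ * R ^ 4 / μ ^ 2 * ((d : ℝ) * (s : ℝ) ^ 2 / ((s' : ℝ) - (s : ℝ)))) +
            accuracyLog Δ ε ^ 2 *
              (κ * R ^ 2 / μ * ((d : ℝ) * (s : ℝ) / ((s' : ℝ) - (s : ℝ))) *
                ((σ : ℝ) ^ 2 / ε))) ∧
        ∀ (Ω : Type*) [MeasurableSpace Ω] (P : Measure Ω) [IsProbabilityMeasure P]
          (Z : ℕ × ℕ × ℕ → Ω → Vec d × ℝ),
          (∀ n, Measurable (Z n)) → (∀ n, P.map (Z n) = D) → iIndepFun Z P →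
          1 - δ ≤ P.real {ω |
            risk D (exploration H (a / L) s' s B (fun n => Z n ω) θ₀ T) - risk D θstar ≤ ε} := by
  refine ⟨64, 1 / 2, 1 / 32, 6534 * 10248, by norm_num, by norm_num, by norm_num, by norm_num,
    by norm_num, ?_⟩
  intro d D θstar σ R s s' L μ κ H θ₀ Δ δ ε hD hb hs hss hd hL hsm hμ hsc hκ hstar hH hΔ hδ0 hδ1 hε
  have := hD.prob
  have hd2 : 2 ≤ d := by omega
  have hκ1 : 1 ≤ κ := hκ ▸ one_le_of_strong_convexity_smoothness hs (by omega) hμ hsm hsc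
  have hκ0 : 0 < κ := by linarith
  have hR : 0 ≤ R := by
    obtain ⟨z, hz⟩ := hb.exists
    exact (abs_nonneg _).trans (hz ⟨0, by omega⟩)
  have hℓ := half_le_confidenceLog hκ1 hd2 hδ0 hδ1 Δ ε
  have hA₁ := quarter_le_batch_term hs hL hμ hκ (hD.strong_convexity_le hb hs (by omega) hsc)
  set ℓ := confidenceLog κ d δ Δ ε with hℓdef
  set A₁ := κ ^ 2 * (R ^ 4 / L ^ 2) * (s : ℝ) ^ 2 with hA₁def
  have hw : (0 : ℝ) < (s' : ℝ) - s := by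
    have : (s : ℝ) < s' := by exact_mod_cast hss
    linarith
  have hα0 : 0 < 1 / 32 / κ := by positivity
  have hα : 1 / 32 / κ ≤ 1 / 32 := div_le_self (by norm_num) hκ1
  -- Pays for rounding the batch size up. It holds for every `A`, so the value of the second term
  -- when `Δ` is zero is irrelevant.
  have hunit : ∀ A, 1 ≤ 8 * ℓ * max A₁ A := by
    intro A
    nlinarith [le_max_left A₁ A, mul_le_mul hℓ (hA₁.trans (le_max_left A₁ A)) (by norm_num)
      (by linarith)]
  -- If the starting point is already accurate, zero rounds suffice.
  rcases le_or_gt Δ ε with hΔε | hΔε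
  · refine ⟨0, fun _ => 1, fun _ => ⟨le_rfl, ?_⟩, ?_, ?_⟩
    · have := hunit ((σ : ℝ) ^ 2 / Δ * (R ^ 2 / L) *
        (((0 : ℕ) : ℝ) * (s : ℝ) / (1 - 1 / 32 / κ) ^ 0))
      push_cast at this ⊢
      nlinarith
    · have hΛ := one_le_accuracyLog Δ ε
      simp only [sampleCount]
      rw [Finset.Icc_eq_empty (by norm_num), Finset.sum_empty, Nat.cast_zero]
      positivity
    · intro Ω _ P _ Z _ _ _
      have : {ω | risk D (exploration H (1 / 2 / L) s' s (fun _ => 1) (fun n => Z n ω) θ₀ 0)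
          - risk D θstar ≤ ε} = Set.univ :=
        Set.eq_univ_of_forall fun ω => show risk D (H θ₀) - risk D θstar ≤ ε by
          rw [← hΔ]; exact hΔε
      rw [this, probReal_univ]
      linarith
  · have hΔ0 : 0 < Δ := hε.trans hΔε
    obtain ⟨T, hT1, hTε, hTlow, hT⟩ := exists_rounds hα0 hα hε hΔε
    replace hT : (T : ℝ) ≤ 33 * κ * accuracyLog Δ ε := by
      refine hT.trans (le_of_eq ?_)
      field_simp
    have hT0 : (0 : ℝ) < T := by exact_mod_cast hT1
    have hd0 : (0 : ℝ) < d := by positivity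
    have hp0 : 0 < (1 - 1 / 32 / κ) ^ T := pow_pos (by linarith) _
    set p := (1 - 1 / 32 / κ) ^ T with hp
    set l := Real.log (2 * d * T / δ) with hldef
    have hl0 : 0 ≤ l := by
      refine Real.log_nonneg ?_
      rw [le_div_iff₀ hδ0]
      have : (2 : ℝ) ≤ d := by exact_mod_cast hd2
      have : (1 : ℝ) ≤ T := by exact_mod_cast hT1
      nlinarith
    have hl : l ≤ 8 * ℓ := log_union_le hκ1 hd2 hδ0 hδ1 Δ ε hT1 hT
    set A₂ := (σ : ℝ) ^ 2 / Δ * (R ^ 2 / L) * ((T : ℝ) * (s : ℝ) / p) with hA₂def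
    have hmax0 : 0 ≤ max A₁ A₂ := le_trans (by linarith) (le_max_left _ _)
    -- One batch size serves all rounds. The constant is `10248 = 1280 * 8 + 8`: `l ≤ 8ℓ` gives the
    -- product, and `hunit` pays for the ceiling.
    obtain ⟨B, hBlow, hB1, hBup⟩ : ∃ B : ℕ, 1280 * l * max A₁ A₂ ≤ B ∧ 1 ≤ B ∧
        (B : ℝ) ≤ 10248 * ℓ * max A₁ A₂ := by
      refine ⟨⌈1280 * l * max A₁ A₂⌉₊ ⊔ 1, ?_, le_sup_right, ?_⟩
      · exact (Nat.le_ceil _).trans (by exact_mod_cast le_sup_left)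
      · have h1 := hunit A₂
        have h2 := (Nat.ceil_lt_add_one (show 0 ≤ 1280 * l * max A₁ A₂ by positivity)).le
        have h3 : 1280 * l * max A₁ A₂ ≤ 1280 * (8 * ℓ) * max A₁ A₂ := by gcongr
        rw [Nat.cast_max]
        refine max_le (by linarith) ?_
        push_cast
        have h4 : 0 ≤ ℓ * max A₁ A₂ := by positivity
        linarith
    have hcount := sampleCount_const_le (R := R) (σ := σ) hss hd hL hμ hκ hε hΔ0 B T hT hp0
      (K := 10248) (by norm_num) (show 0 ≤ ℓ by linarith) hTlow hBup
    refine ⟨T, fun _ => B, fun _ => ⟨hB1, hBup.trans ?_⟩, hcount, ?_⟩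
    · have h4 : 0 ≤ ℓ * max A₁ A₂ := by positivity
      linarith
    · intro Ω _ P _ Z hZ hlaw hind
      have hprob := hD.measure_accurate_ge hb hR hH.measurable (1 / 2 / L) hss (fun _ => B)
        (fun _ => hB1) θ₀ hZ hlaw hind T hl0
      have hδeq : T * d * (2 * Real.exp (-l)) = δ := by
        rw [Real.exp_neg, hldef, Real.exp_log (by positivity)]
        field_simp
      rw [hδeq] at hprob
      refine hprob.trans (measureReal_mono fun ω hω => ?_)
      have hgap := hD.exploration_gap_le hb hR hH hs hL hμ hsm hsc hκ hκ1 hstar B θ₀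
        (fun n => Z n ω) T hl0 hB1
        (le_trans (mul_le_mul_of_nonneg_left (le_max_left _ _) (by positivity)) hBlow) hω
      rw [← hp, ← hΔ] at hgap
      -- The factor `1 / p` in `A₂` brings the accumulated noise down to the level of the contracted
      -- initial gap; the two together are at most `2 * p * Δ ≤ ε`.
      have hnoise : T * (10 * s * R ^ 2 * σ ^ 2 * l / (L * B)) ≤ p * Δ := by
        have hBpos : (0 : ℝ) < B := by exact_mod_cast hB1
        have h1 : 1280 * l * A₂ ≤ B :=
          le_trans (mul_le_mul_of_nonneg_left (le_max_right _ _) (by positivity)) hBlow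
        have h2 : 10 * l * A₂ ≤ B := by
          have : 0 ≤ l * A₂ := by positivity
          linarith
        have h3 : T * (10 * s * R ^ 2 * σ ^ 2 * l / (L * B)) = 10 * l * A₂ * (p * Δ) / B := by
          rw [hA₂def]; field_simp
        rw [h3, div_le_iff₀ hBpos, mul_comm (p * Δ)]
        gcongr
      show risk D _ - risk D θstar ≤ ε
      linarith
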